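/- For an open set $X\subset\mathbb C^d$ let $K_X$ be its Kobayashi pseudodistance: $K_X(z,w)$ is the infimum of the lengths, measured with the Poincaré distance of the unit disc $\mathbb D$, of finite chains of holomorphic discs $\mathbb D\to X$ joining $z$ to $w$ ($+\infty$ if there is no chain). Call $X$ *complete hyperbolic* if $(X,K_X)$ is a complete metric space (the value $+\infty$ being allowed when $X$ is not connected). A geodesic for $K_X$ joining $x,y\in X$ is an isometric embedding of a compact real interval into $(X,K_X)$ with end points $x,y$. A domain $X$ is *Gromov hyperbolic* if there is $\delta>0$ such that in every geodesic triangle each point of each side has $K_X$-distance at most $\delta$ from the union of the other two sides. Points $p\ne q$ of $\mathbb C^d$ *satisfy the visibility condition for $K_X$* if there are disjoint neighborhoods $V_p$ of $p$ and $V_q$ of $q$ and a compact set $K\subset X$ such that every geodesic for $K_X$ joining a point of $V_p\cap X$ to a point of $V_q\cap X$ meets $K$. A domain $X$ is *visible* if every pair of distinct points of its Euclidean boundary $\partial X$ satisfies the visibility condition for $K_X$. **Proposition.** Let $\Omega\subset\mathbb C^d$ be a bounded domain that is complete hyperbolic, Gromov hyperbolic and visible, and let $p\in\partial\Omega$. 1.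 If $W$ is an open neighborhood of $p$ such that $\Omega\cap W$ is connected and complete hyperbolic, then every pair of distinct points of $\partial\Omega\cap W$ satisfies the visibility condition for $K_{\Omega\cap W}$. 2. If $W$ is an open neighborhood of $p$ such that $\Omega\cap W$ is connected and $W$ is complete hyperbolic, then $\Omega\cap W$ is complete hyperbolic, and hence the conclusion of (1) holds for $W$. 3. If $p$ has a countable basis of open neighborhoods $W_j$ such that every $\Omega\cap W_j$ is connected, then $p$ has a countable basis of open neighborhoods $W'_j$ such that every $\Omega\cap W'_j$ is connected and complete hyperbolic and every pair of distinct points of $\partial\Omega\cap W'_j$ satisfies the visibility condition for $K_{\Omega\cap W'_j}$. -/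

import Mathlib

open Set Filter Topology
open scoped ENNReal ComplexConjugate

noncomputable section

namespace Kobayashi

/-- The space `ℂ^d` with its Euclidean norm. -/
abbrev Cn (d : ℕ) : Type := EuclideanSpace ℂ (Fin d)

/-- The open unit disc of `ℂ`. -/
def disc : Set ℂ := Metric.ball 0 1

/-- The Poincaré distance of the unit disc (only used for `a`, `b` in the disc). -/
def poincareDist (a b : ℂ) : ℝ := Real.artanh ‖(a - b) / (1 - conj b * a)‖

/-- The Lempert function of `X`: the infimum of the Poincaré distances of points `a`, `b` of the
disc for which some holomorphic map from the disc to `X` sends `a` to `z` and `b` to `w`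
(the value is `∞` if there is no such map). -/
def lempert {d : ℕ} (X : Set (Cn d)) (z w : Cn d) : ℝ≥0∞ :=
  ⨅ (f : ℂ → Cn d) (a : ℂ) (b : ℂ) (_ : DifferentiableOn ℂ f disc) (_ : MapsTo f disc X)
    (_ : a ∈ disc) (_ : b ∈ disc) (_ : f a = z) (_ : f b = w), ENNReal.ofReal (poincareDist a b)

/-- The Kobayashi pseudodistance `K_X`: the infimum of the lengths of finite chains of holomorphic
discs in `X` from `z` to `w`. It is used for `z`, `w` in an open set `X`; it is finite if `X` is
connected, and it is `∞` for points in different connected components of `X`. -/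
def kob {d : ℕ} (X : Set (Cn d)) (z w : Cn d) : ℝ≥0∞ :=
  ⨅ (n : ℕ) (c : ℕ → Cn d) (_ : c 0 = z) (_ : c n = w),
    ∑ i ∈ Finset.range n, lempert X (c i) (c (i + 1))

/-- `(X, K_X)` is a complete metric space: `K_X` separates the points of `X`, and every
`K_X`-Cauchy sequence in `X` converges with respect to `K_X` to a point of `X`. -/
def IsCompleteHyperbolic {d : ℕ} (X : Set (Cn d)) : Prop :=
  (∀ z ∈ X, ∀ w ∈ X, kob X z w = 0 → z = w) ∧
  ∀ u : ℕ → Cn d, (∀ n, u n ∈ X) →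
    (∀ ε : ℝ≥0∞, 0 < ε → ∃ N, ∀ m ≥ N, ∀ n ≥ N, kob X (u m) (u n) < ε) →
    ∃ z ∈ X, Tendsto (fun n => kob X (u n) z) atTop (𝓝 0)

/-- `S` is (the image of) a geodesic segment for `K_X` in `X` joining `x` to `y`. -/
def IsGeodesicSegment {d : ℕ} (X : Set (Cn d)) (x y : Cn d) (S : Set (Cn d)) : Prop :=
  ∃ (L : ℝ) (γ : ℝ → Cn d), 0 ≤ L ∧ MapsTo γ (Icc 0 L) X ∧ γ 0 = x ∧ γ L = y ∧
    (∀ s ∈ Icc 0 L, ∀ t ∈ Icc 0 L, kob X (γ s) (γ t) = ENNReal.ofReal |s - t|) ∧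
    S = γ '' Icc 0 L

/-- `(X, K_X)` is Gromov hyperbolic: there is `δ > 0` such that every geodesic triangle is
`δ`-thin. (It suffices to speak of the first side, since the vertices may be permuted
cyclically.) -/
def IsGromovHyperbolic {d : ℕ} (X : Set (Cn d)) : Prop :=
  ∃ δ : ℝ, 0 < δ ∧ ∀ x ∈ X, ∀ y ∈ X, ∀ z ∈ X, ∀ S₁ S₂ S₃ : Set (Cn d),
    IsGeodesicSegment X x y S₁ → IsGeodesicSegment X y z S₂ → IsGeodesicSegment X z x S₃ →
    ∀ a ∈ S₁, ∃ b ∈ S₂ ∪ S₃, kob X a b ≤ ENNReal.ofReal δ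

/-- The pair `(p, q)` satisfies the visibility condition for `K_X`: for suitable disjoint
neighbourhoods of `p` and `q`, all geodesics for `K_X` joining points of `X` in these
neighbourhoods meet a fixed compact subset of `X`. -/
def VisibilityCondition {d : ℕ} (X : Set (Cn d)) (p q : Cn d) : Prop :=
  ∃ V ∈ 𝓝 p, ∃ V' ∈ 𝓝 q, ∃ K : Set (Cn d), IsCompact K ∧ K ⊆ X ∧ Disjoint V V' ∧
    ∀ x ∈ V ∩ X, ∀ y ∈ V' ∩ X, ∀ S, IsGeodesicSegment X x y S → (S ∩ K).Nonempty

/-- `X` is visible: every pair of distinct Euclidean boundary points satisfies the visibility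
condition. -/
def IsVisible {d : ℕ} (X : Set (Cn d)) : Prop :=
  ∀ p ∈ frontier X, ∀ q ∈ frontier X, p ≠ q → VisibilityCondition X p q

/-- Every pair of distinct points of `∂Ω ∩ W` satisfies the visibility condition for
`K_{Ω ∩ W}`. -/
def IsVisibleNhd {d : ℕ} (Ω W : Set (Cn d)) : Prop :=
  ∀ q₁ ∈ frontier Ω ∩ W, ∀ q₂ ∈ frontier Ω ∩ W, q₁ ≠ q₂ → VisibilityCondition (Ω ∩ W) q₁ q₂

end Kobayashi

end

/-! Write `K` for the distance of `Ω` and `K'` for that of `Ω ∩ W`. The point is that a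
`K'`-geodesic close to `q₁` is a quasi-geodesic for `K`. One inequality, `K ≤ K'`, is monotonicity.
The other, `K' ≤ A * K + C` near `q₁`, is `exists_kob_inter_le`. Along a `K`-geodesic that stays
near `q₁`, discs can be shrunk into `W` at the cost of a factor. A `K`-geodesic that goes far away
meets, by visibility, a fixed compact set soon after leaving one end point and shortly before
reaching the other, and the excursion in between is replaced by a path of bounded `K'`-length.

Let a `K'`-geodesic run from near `q₁` to near `q₂`, and stop it at its first exit from a ball about
`q₁`. By the Morse lemma (`HasThinTriangles.geodesic_near_quasigeodesic`) a `K`-geodesic with the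
same end points lies within `M` of this piece. By visibility of `Ω` the `K`-geodesic meets a compact
set `K₀`, so the piece meets the closed `M`-neighbourhood of `K₀`. That neighbourhood is compact
because a complete locally compact length space is proper (`IsLengthMetric.properSpace`); such a
space is also geodesic.

Complete hyperbolicity passes to intersections and to connected components, since a Cauchy sequence
has a Euclidean limit in each larger set. Balls are complete hyperbolic by a Harnack inequality. The
neighbourhoods in (3) therefore come from components of `Ω ∩ ball`. -/

noncomputable section

/-! ### Length spaces, geodesics and Gromov hyperbolicity -/

namespace MetricGeometry

variable {X : Type*} [MetricSpace X]

/-- `S` is the image of a geodesic segment from `x` to `y`. -/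
def IsSegment (x y : X) (S : Set X) : Prop :=
  ∃ (L : ℝ) (γ : ℝ → X), 0 ≤ L ∧ γ 0 = x ∧ γ L = y ∧
    (∀ s ∈ Icc 0 L, ∀ t ∈ Icc 0 L, dist (γ s) (γ t) = |s - t|) ∧ S = γ '' Icc 0 L

/-- Approximate intermediate points exist: the metric is a length metric. -/
def IsLengthMetric (X : Type*) [MetricSpace X] : Prop :=
  ∀ (x y : X) (a b : ℝ), 0 ≤ a → 0 ≤ b → dist x y < a + b → ∃ m, dist x m ≤ a ∧ dist m y ≤ b

/-- Any two points are joined by a geodesic segment. -/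
def IsGeodesicSpace (X : Type*) [MetricSpace X] : Prop :=
  ∀ x y : X, ∃ S, IsSegment x y S

/-- All geodesic triangles are `δ`-thin. -/
def HasThinTriangles (X : Type*) [MetricSpace X] (δ : ℝ) : Prop :=
  ∀ (x y z : X) (S₁ S₂ S₃ : Set X), IsSegment x y S₁ → IsSegment y z S₂ → IsSegment z x S₃ →
    ∀ a ∈ S₁, ∃ b ∈ S₂ ∪ S₃, dist a b ≤ δ

/-- The thickening is by `2 * ε` because `IsLengthMetric` asks for a strict inequality. -/
lemma IsLengthMetric.closedBall_subset_cthickening (hX : IsLengthMetric X) (x : X) {r ε : ℝ}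
    (hr : 0 ≤ r) (hε : 0 < ε) :
    Metric.closedBall x (r + ε) ⊆ Metric.cthickening (2 * ε) (Metric.closedBall x r) := by
  intro y hy
  rw [Metric.mem_closedBall'] at hy
  obtain ⟨m, hm1, hm2⟩ := hX x y r (2 * ε) hr (by positivity) (by linarith)
  exact Metric.mem_cthickening_of_dist_le y m _ _ (Metric.mem_closedBall'.2 hm1)
    (by rwa [dist_comm])

/-- The Hopf–Rinow–Cohn-Vossen theorem. -/
theorem IsLengthMetric.properSpace [CompleteSpace X] [LocallyCompactSpace X]
    (hX : IsLengthMetric X) : ProperSpace X := by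
  refine ⟨fun x r₀ => ?_⟩
  by_contra hcon
  set S : Set ℝ := {r | 0 ≤ r ∧ IsCompact (Metric.closedBall x r)} with hS
  have h0 : (0 : ℝ) ∈ S := ⟨le_rfl, by simp⟩
  have hmono : ∀ {r s : ℝ}, r ≤ s → IsCompact (Metric.closedBall x s) →
      IsCompact (Metric.closedBall x r) := fun hrs hs =>
    hs.of_isClosed_subset Metric.isClosed_closedBall (Metric.closedBall_subset_closedBall hrs)
  have hbdd : BddAbove S := ⟨r₀, fun r hr => by
    by_contra! h
    exact hcon (hmono h.le hr.2)⟩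
  set R := sSup S with hR
  have hR0 : 0 ≤ R := le_csSup hbdd h0
  have hlt : ∀ r < R, IsCompact (Metric.closedBall x r) := fun r hr => by
    obtain ⟨s, hs, hrs⟩ := exists_lt_of_lt_csSup ⟨0, h0⟩ hr
    exact hmono hrs.le hs.2
  -- Points of the `R`-ball are within `ε / 2` of a smaller, compact ball, so the `R`-ball is
  -- totally bounded.
  have hRc : IsCompact (Metric.closedBall x R) := by
    rw [isCompact_iff_totallyBounded_isComplete]
    refine ⟨Metric.totallyBounded_iff.2 fun ε hε => ?_, Metric.isClosed_closedBall.isComplete⟩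
    have hc : IsCompact (Metric.closedBall x (max 0 (R - ε / 4))) := by
      rcases le_total (R - ε / 4) 0 with h | h
      · rw [max_eq_left h]; exact h0.2
      · rw [max_eq_right h]; exact hlt _ (by linarith)
    obtain ⟨t, ht, htc⟩ := Metric.totallyBounded_iff.1 hc.totallyBounded (ε / 2) (by positivity)
    refine ⟨t, ht, fun y hy => ?_⟩
    rw [Metric.mem_closedBall'] at hy
    have h1 := le_max_right 0 (R - ε / 4)
    obtain ⟨m, hm1, hm2⟩ := hX x y (max 0 (R - ε / 4)) (ε / 2) (le_max_left _ _)
      (by positivity) (by linarith)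
    have := htc (Metric.mem_closedBall'.2 hm1)
    simp only [mem_iUnion, Metric.mem_ball] at this ⊢
    obtain ⟨i, hi, hmi⟩ := this
    refine ⟨i, hi, ?_⟩
    have := dist_triangle y m i
    rw [dist_comm y m] at this
    linarith
  -- Local compactness thickens the compact ball, which contradicts the choice of `R` as a supremum.
  obtain ⟨δ, hδ, hδc⟩ := hRc.exists_isCompact_cthickening
  have : R + δ / 2 ∈ S := ⟨by positivity, hδc.of_isClosed_subset Metric.isClosed_closedBall (by
    have := hX.closedBall_subset_cthickening x hR0 (half_pos hδ)
    rwa [mul_div_cancel₀ _ (two_ne_zero)] at this)⟩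
  have := le_csSup hbdd this
  linarith

lemma IsLengthMetric.exists_chain (hX : IsLengthMetric X) {a : ℝ} (ha : 0 ≤ a) (N : ℕ) :
    ∀ x y : X, dist x y < (N + 1) * a →
      ∃ g : ℕ → X, g 0 = x ∧ g (N + 1) = y ∧ ∀ i, dist (g i) (g (i + 1)) ≤ a := by
  induction N with
  | zero =>
    intro x y h
    refine ⟨fun i => if i = 0 then x else y, by simp, by simp, fun i => ?_⟩
    rcases i with _ | i
    · simp at h ⊢; exact h.le
    · simpa using ha
  | succ N ih =>
    intro x y h
    push_cast at h
    have key : ∃ m, dist x m ≤ a ∧ dist m y < (N + 1) * a := by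
      by_cases hxy : dist x y < (N + 1) * a
      · exact ⟨x, by simpa using ha, hxy⟩
      · push Not at hxy
        have hN : 0 ≤ N * a := by positivity
        -- The second radius is the mean of `dist x y - a` and `(N + 1) * a`, so both strict
        -- inequalities survive.
        obtain ⟨m, h1, h2⟩ := hX x y a (((N + 1) * a + dist x y - a) / 2) ha (by linarith)
          (by linarith)
        exact ⟨m, h1, by linarith⟩
    obtain ⟨m, h1, h2⟩ := key
    obtain ⟨g, hg0, hg1, hg⟩ := ih m y h2
    refine ⟨fun i => if i = 0 then x else g (i - 1), by simp, by simpa using hg1, fun i => ?_⟩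
    rcases i with _ | i
    · simpa [hg0] using h1
    · simpa using hg i

lemma dist_le_of_steps {g : ℕ → X} {a : ℝ} (hg : ∀ i, dist (g i) (g (i + 1)) ≤ a) {i j : ℕ}
    (hij : i ≤ j) : dist (g i) (g j) ≤ ((j : ℝ) - i) * a := by
  have := dist_le_Ico_sum_of_dist_le (f := g) hij (d := fun _ => a) (fun {k} _ _ => hg k)
  simpa [Nat.cast_sub hij] using this

theorem IsLengthMetric.isGeodesicSpace [ProperSpace X] (hX : IsLengthMetric X) :
    IsGeodesicSpace X := by
  intro x y
  rcases eq_or_ne x y with rfl | hxy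
  · exact ⟨_, 0, fun _ => x, le_rfl, rfl, rfl, by simp, rfl⟩
  set L := dist x y with hL
  have hLpos : 0 < L := dist_pos.2 hxy
  have hch : ∀ n : ℕ, ∃ g : ℕ → X, g 0 = x ∧ g (n + 2) = y ∧
      ∀ i, dist (g i) (g (i + 1)) ≤ L / (n + 1) := fun n => by
    refine hX.exists_chain (by positivity) (n + 1) x y ?_
    push_cast
    rw [mul_div_assoc', lt_div_iff₀ (by positivity)]
    nlinarith
  choose g hg0 hg1 hg using hch
  -- Chains of `n + 2` steps of length at most `L / (n + 1)`, parametrized so that time `L` is the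
  -- last index.
  set γ : ℕ → ℝ → X := fun n t => g n ⌊t * (n + 2) / L⌋₊ with hγ
  have hdist : ∀ n, ∀ s t, 0 ≤ s → s ≤ t →
      dist (γ n s) (γ n t) ≤ (t - s) * ((n + 2) / (n + 1)) + L / (n + 1) := by
    intro n s t hs hst
    have hle : s * (n + 2) / L ≤ t * (n + 2) / L := by gcongr
    have h1 := dist_le_of_steps (hg n) (Nat.floor_le_floor hle)
    have h2 := Nat.floor_le (a := t * (n + 2) / L) (by have := hs.trans hst; positivity)
    have h3 := (Nat.lt_floor_add_one (s * (n + 2) / L)).le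
    refine h1.trans ?_
    calc _ ≤ (t * (n + 2) / L - (s * (n + 2) / L - 1)) * (L / (n + 1)) := by
          gcongr; linarith
      _ = _ := by field_simp; ring
  have hγ0 : ∀ n, γ n 0 = x := fun n => by simp [hγ, hg0]
  have hγL : ∀ n, γ n L = y := fun n => by
    have : L * ((n : ℝ) + 2) / L = ((n + 2 : ℕ) : ℝ) := by
      push_cast; field_simp
    simp only [hγ, this, Nat.floor_natCast, hg1]
  -- An ultrafilter limit exists at all times at once, which replaces Arzelà–Ascoli.
  have hlim : ∀ t, ∃ p, 0 ≤ t → Tendsto (fun n => γ n t) (hyperfilter ℕ) (𝓝 p) := by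
    intro t
    by_cases ht : 0 ≤ t
    swap
    · exact ⟨x, fun h => absurd h ht⟩
    have hb : ∀ n, γ n t ∈ Metric.closedBall x (t * 2 + L) := fun n => by
      have := hdist n 0 t le_rfl ht
      rw [hγ0] at this
      rw [Metric.mem_closedBall']
      refine this.trans ?_
      have h1 : ((n : ℝ) + 2) / (n + 1) ≤ 2 := by
        rw [div_le_iff₀ (by positivity)]; have : (0 : ℝ) ≤ n := by positivity
        linarith
      have h2 : L / ((n : ℝ) + 1) ≤ L := div_le_self hLpos.le (by simp)
      rw [sub_zero]
      gcongr
    obtain ⟨p, -, hp⟩ := (isCompact_closedBall x (t * 2 + L)).ultrafilter_le_nhds'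
      ((hyperfilter ℕ).map (fun n => γ n t)) (Filter.mem_map.2 (Eventually.of_forall hb))
    exact ⟨p, fun _ => hp⟩
  choose c hc using hlim
  have hn1 : Tendsto (fun n : ℕ => L / ((n : ℝ) + 1)) (hyperfilter ℕ) (𝓝 0) :=
    (tendsto_const_div_atTop_nhds_zero_nat L |>.comp (tendsto_add_atTop_nat 1)
      |>.congr (fun n => by simp)).mono_left Nat.hyperfilter_le_atTop
  have hn2 : Tendsto (fun n : ℕ => ((n : ℝ) + 2) / (n + 1)) (hyperfilter ℕ) (𝓝 1) := by
    have : Tendsto (fun n : ℕ => 1 + 1 / ((n : ℝ) + 1)) atTop (𝓝 (1 + 0)) :=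
      tendsto_const_nhds.add tendsto_one_div_add_atTop_nhds_zero_nat
    rw [add_zero] at this
    refine (this.congr fun n => ?_).mono_left Nat.hyperfilter_le_atTop
    field_simp; ring
  have hup : ∀ s t, 0 ≤ s → s ≤ t → dist (c s) (c t) ≤ t - s := by
    intro s t hs hst
    have h1 := (hc s hs).dist (hc t (hs.trans hst))
    have h2 := (hn2.const_mul (t - s)).add hn1
    simp only [mul_one, add_zero] at h2
    exact le_of_tendsto_of_tendsto' h1 h2 fun n => hdist n s t hs hst
  have hc0 : c 0 = x := tendsto_nhds_unique (hc 0 le_rfl) (by simp [hγ0])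
  have hcL : c L = y := tendsto_nhds_unique (hc L hLpos.le) (by simp [hγL])
  -- A 1-Lipschitz curve that covers the distance `L` in time `L` wastes no length.
  have hle : ∀ s t, 0 ≤ s → s ≤ t → t ≤ L → dist (c s) (c t) = t - s := by
    intro s t hs hst htL
    refine le_antisymm (hup s t hs hst) ?_
    have h1 := hup 0 s le_rfl hs
    have h2 := hup t L (hs.trans hst) htL
    rw [hc0] at h1
    rw [hcL] at h2
    have := dist_triangle4 x (c s) (c t) y
    linarith
  refine ⟨_, L, c, hLpos.le, hc0, hcL, fun s hs t ht => ?_, rfl⟩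
  rcases le_total s t with h | h
  · rw [hle s t hs.1 h ht.2, abs_sub_comm, abs_of_nonneg (by linarith)]
  · rw [dist_comm, hle t s ht.1 h hs.2, abs_of_nonneg (by linarith)]

lemma IsSegment.symm {x y : X} {S : Set X} (h : IsSegment x y S) : IsSegment y x S := by
  obtain ⟨L, γ, hL, h0, h1, hd, rfl⟩ := h
  have hm : ∀ s ∈ Icc 0 L, L - s ∈ Icc 0 L := fun s hs => ⟨by linarith [hs.2], by linarith [hs.1]⟩
  refine ⟨L, fun t => γ (L - t), hL, by simpa, by simpa, fun s hs t ht => ?_, ?_⟩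
  · rw [hd _ (hm s hs) _ (hm t ht), abs_sub_comm]
    congr 1; ring
  · ext p
    constructor
    · rintro ⟨s, hs, rfl⟩
      exact ⟨L - s, hm s hs, by simp⟩
    · rintro ⟨s, hs, rfl⟩
      exact ⟨L - s, hm s hs, rfl⟩

lemma isSegment_restrict {γ : ℝ → X} {L : ℝ}
    (hd : ∀ s ∈ Icc 0 L, ∀ t ∈ Icc 0 L, dist (γ s) (γ t) = |s - t|) {s t : ℝ} (hs : 0 ≤ s)
    (hst : s ≤ t) (ht : t ≤ L) : IsSegment (γ s) (γ t) (γ '' Icc s t) := by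
  refine ⟨t - s, fun u => γ (s + u), by linarith, by simp, by simp, fun u hu v hv => ?_, ?_⟩
  · rw [hd _ ⟨by linarith [hu.1], by linarith [hu.2]⟩ _ ⟨by linarith [hv.1], by linarith [hv.2]⟩]
    congr 1; ring
  · ext p
    constructor
    · rintro ⟨u, hu, rfl⟩
      exact ⟨u - s, ⟨by linarith [hu.1], by linarith [hu.2]⟩, by simp⟩
    · rintro ⟨u, hu, rfl⟩
      exact ⟨s + u, ⟨by linarith [hu.1], by linarith [hu.2]⟩, rfl⟩

lemma IsSegment.dist_add_dist {x y a : X} {S : Set X} (h : IsSegment x y S) (ha : a ∈ S) :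
    dist x a + dist a y = dist x y := by
  obtain ⟨L, γ, hL, rfl, rfl, hd, rfl⟩ := h
  obtain ⟨s, hs, rfl⟩ := ha
  rw [hd _ ⟨le_rfl, hL⟩ _ hs, hd _ hs _ ⟨hL, le_rfl⟩, hd _ ⟨le_rfl, hL⟩ _ ⟨hL, le_rfl⟩,
    abs_of_nonpos (by linarith [hs.1]), abs_of_nonpos (by linarith [hs.2]),
    abs_of_nonpos (by linarith)]
  ring

/-- In a space with `δ`-thin triangles, a geodesic polygon with `2 ^ k + 1` vertices is
`k * δ`-thin. -/
lemma HasThinTriangles.polygon {δ : ℝ} (hX : HasThinTriangles X δ) (hg : IsGeodesicSpace X)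
    (k : ℕ) : ∀ (w : ℕ → X) (S : Set X), IsSegment (w 0) (w (2 ^ k)) S → ∀ a ∈ S,
      ∃ i < 2 ^ k, ∃ S', IsSegment (w i) (w (i + 1)) S' ∧ ∃ b ∈ S', dist a b ≤ k * δ := by
  induction k with
  | zero => exact fun w S hS a ha => ⟨0, by simp, S, by simpa using hS, a, ha, by simp⟩
  | succ k ih =>
    intro w S hS a ha
    -- Cut the polygon at its middle vertex; each halving costs one `δ`.
    obtain ⟨S₂, hS₂⟩ := hg (w 0) (w (2 ^ k))
    obtain ⟨S₃, hS₃⟩ := hg (w (2 ^ k)) (w (2 ^ (k + 1)))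
    obtain ⟨b, hb, hab⟩ := hX _ _ _ _ _ _ hS hS₃.symm hS₂.symm a ha
    have hpow : 2 ^ (k + 1) = 2 ^ k + 2 ^ k := by ring
    rcases hb with hb | hb
    · obtain ⟨i, hi, S', hS', e, he, hbe⟩ := ih (fun i => w (2 ^ k + i)) S₃
        (by simpa [← hpow] using hS₃) b hb
      refine ⟨2 ^ k + i, by omega, S', hS', e, he, ?_⟩
      push_cast
      linarith [dist_triangle a b e]
    · obtain ⟨i, hi, S', hS', e, he, hbe⟩ := ih w S₂ hS₂ b hb
      refine ⟨i, by omega, S', hS', e, he, ?_⟩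
      push_cast
      linarith [dist_triangle a b e]

/-- Cutting the curve into `2 ^ k` pieces of duration at most `1` gives a polygon with sides of
length at most `1`. The thinness of polygons is thus logarithmic in the length of the curve. -/
lemma HasThinTriangles.exists_dist_le_of_lipschitz {δ : ℝ} (hX : HasThinTriangles X δ)
    (hg : IsGeodesicSpace X) {c : ℝ → X} {T : ℝ}
    (hc : ∀ s ∈ Icc 0 T, ∀ t ∈ Icc 0 T, dist (c s) (c t) ≤ |s - t|) {s t : ℝ}
    (hs : s ∈ Icc 0 T) (ht : t ∈ Icc 0 T) {k : ℕ} (hk : |s - t| ≤ 2 ^ k) {S : Set X}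
    (hS : IsSegment (c s) (c t) S) {a : X} (ha : a ∈ S) :
    ∃ u ∈ Icc 0 T, dist a (c u) ≤ k * δ + 1 := by
  have hmem : ∀ i : ℕ, i ≤ 2 ^ k → s + (t - s) * (i / 2 ^ k) ∈ Icc 0 T := fun i hi => by
    have h1 : (i : ℝ) / 2 ^ k ≤ 1 := by
      rw [div_le_one (by positivity)]; exact_mod_cast hi
    have := (convex_Icc 0 T).add_smul_sub_mem hs ht (t := (i : ℝ) / 2 ^ k) ⟨by positivity, h1⟩
    rwa [smul_eq_mul, mul_comm] at this
  obtain ⟨i, hi, S', hS', b, hb, hab⟩ := hX.polygon hg k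
    (fun i : ℕ => c (s + (t - s) * (i / 2 ^ k))) S (by simpa using hS) a ha
  refine ⟨_, hmem i hi.le, ?_⟩
  have h1 := hS'.dist_add_dist hb
  have h2 := hc _ (hmem i hi.le) _ (hmem (i + 1) hi)
  have h3 : |s + (t - s) * (i / 2 ^ k) - (s + (t - s) * ((i + 1 : ℕ) / 2 ^ k))| ≤ 1 := by
    rw [show s + (t - s) * ((i : ℝ) / 2 ^ k) - (s + (t - s) * ((i + 1 : ℕ) / 2 ^ k))
      = (s - t) / 2 ^ k by push_cast; ring, abs_div, abs_of_pos (by positivity : (0:ℝ) < 2 ^ k),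
      div_le_one (by positivity)]
    exact hk
  have := dist_triangle a b (c (s + (t - s) * (i / 2 ^ k)))
  rw [dist_comm b] at this
  linarith [dist_nonneg (x := b) (y := c (s + (t - s) * ((i + 1 : ℕ) / 2 ^ k)))]

/-- A geodesic between the end points of a Lipschitz quasi-geodesic in a Gromov hyperbolic space
lies in a uniform neighbourhood of the quasi-geodesic. -/
theorem HasThinTriangles.geodesic_near_quasigeodesic {δ : ℝ} (hδ : 0 < δ)
    (hX : HasThinTriangles X δ) (hg : IsGeodesicSpace X) {A C : ℝ} (hA : 0 ≤ A) :
    ∃ M : ℝ, ∀ (T : ℝ) (c : ℝ → X), 0 ≤ T →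
      (∀ s ∈ Icc 0 T, ∀ t ∈ Icc 0 T, dist (c s) (c t) ≤ |s - t|) →
      (∀ s ∈ Icc 0 T, ∀ t ∈ Icc 0 T, |s - t| ≤ A * dist (c s) (c t) + C) →
      ∀ S, IsSegment (c 0) (c T) S → ∀ a ∈ S, ∃ s ∈ Icc 0 T, dist a (c s) ≤ M := by
  -- Exponential growth beats linear growth; this is what bounds `M`.
  have hgrow : ∃ k₀ : ℕ, ∀ k ≥ k₀, A * (6 * ((k + 3) * δ + 1)) + C ≤ (2 : ℝ) ^ k := by
    have h1 : Tendsto (fun k : ℕ => (k : ℝ) ^ 1 / (2 : ℝ) ^ k) atTop (𝓝 0) :=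
      tendsto_pow_const_div_const_pow_of_one_lt 1 (by norm_num)
    have h2 : Tendsto (fun k : ℕ => (k : ℝ) ^ 0 / (2 : ℝ) ^ k) atTop (𝓝 0) :=
      tendsto_pow_const_div_const_pow_of_one_lt 0 (by norm_num)
    have h3 := (h1.const_mul (A * 6 * δ)).add (h2.const_mul (A * 6 * (3 * δ + 1) + C))
    simp only [mul_zero, add_zero] at h3
    obtain ⟨k₀, hk₀⟩ := eventually_atTop.1 (h3.eventually (ge_mem_nhds zero_lt_one))
    refine ⟨k₀, fun k hk => ?_⟩
    have := hk₀ k hk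
    rw [mul_div_assoc', mul_div_assoc', ← add_div, div_le_one (by positivity)] at this
    refine le_trans (le_of_eq ?_) this
    ring
  obtain ⟨k₀, hk₀⟩ := hgrow
  refine ⟨(k₀ + 2) * δ + 1, fun T c hT hc hq S hS a ha => ?_⟩
  obtain ⟨L, σ, hL, hσ0, hσL, hσ, rfl⟩ := hS
  have hcc : ContinuousOn c (Icc 0 T) := by
    refine (LipschitzOnWith.of_dist_le_mul (K := 1) fun s hs t ht => ?_).continuousOn
    simpa [Real.dist_eq] using hc s hs t ht
  have hσc : ContinuousOn σ (Icc 0 L) := by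
    refine (LipschitzOnWith.of_dist_le_mul (K := 1) fun s hs t ht => ?_).continuousOn
    simpa [Real.dist_eq] using (hσ s hs t ht).le
  have him : IsCompact (c '' Icc 0 T) := isCompact_Icc.image_of_continuousOn hcc
  have hne : (c '' Icc 0 T).Nonempty := ⟨c 0, 0, ⟨le_rfl, hT⟩, rfl⟩
  have hnear : ∀ p, ∃ s ∈ Icc 0 T, Metric.infDist p (c '' Icc 0 T) = dist p (c s) := fun p => by
    obtain ⟨_, ⟨s, hs, rfl⟩, h⟩ := him.exists_infDist_eq_dist hne p
    exact ⟨s, hs, h⟩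
  -- `σ t₀` is the point of the geodesic farthest from the curve, at distance `D`.
  obtain ⟨t₀, ht₀, hmax⟩ := isCompact_Icc.exists_isMaxOn ⟨0, ⟨le_rfl, hL⟩⟩
    ((Metric.continuous_infDist_pt (c '' Icc 0 T)).comp_continuousOn hσc)
  set D := Metric.infDist (σ t₀) (c '' Icc 0 T) with hD
  have hmax' : ∀ t ∈ Icc 0 L, Metric.infDist (σ t) (c '' Icc 0 T) ≤ D := fun t ht => hmax ht
  have hfar : ∀ s ∈ Icc 0 T, D ≤ dist (σ t₀) (c s) := fun s hs =>
    Metric.infDist_le_dist_of_mem ⟨s, hs, rfl⟩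
  have hD0 : 0 ≤ D := Metric.infDist_nonneg
  suffices hmain : D ≤ (k₀ + 2) * δ + 1 by
    obtain ⟨t, ht, rfl⟩ := ha
    obtain ⟨s, hs, h⟩ := hnear (σ t)
    exact ⟨s, hs, h ▸ (hmax' t ht).trans hmain⟩
  -- a point of the geodesic near `σ t₀` on either side, and a nearby point of the curve
  have hleft : ∃ t ∈ Icc 0 L, t ≤ t₀ ∧ t₀ - t ≤ 2 * D ∧ ∃ s ∈ Icc 0 T, dist (σ t) (c s) ≤ D ∧
      ∀ S, IsSegment (σ t) (c s) S → ∀ e ∈ S, D ≤ dist (σ t₀) e := by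
    -- From a point at distance `2 * D`, a segment of length at most `D` stays `D` away from `σ t₀`.
    -- If the geodesic ends sooner, its end point is on the curve and the segment is degenerate.
    by_cases h : 2 * D ≤ t₀
    · have hm : t₀ - 2 * D ∈ Icc 0 L := ⟨by linarith, by linarith [ht₀.2]⟩
      obtain ⟨s, hs, hsd⟩ := hnear (σ (t₀ - 2 * D))
      have hsD := hsd ▸ hmax' _ hm
      refine ⟨t₀ - 2 * D, hm, by linarith, by linarith, s, hs, hsD, fun S hS e he => ?_⟩
      have h1 := hS.dist_add_dist he
      have h2 := hσ _ ht₀ _ hm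
      rw [sub_sub_cancel, abs_of_nonneg (by linarith)] at h2
      have h3 := dist_triangle (σ t₀) e (σ (t₀ - 2 * D))
      rw [dist_comm e] at h3
      linarith [dist_nonneg (x := e) (y := c s)]
    · refine ⟨0, ⟨le_rfl, hL⟩, ht₀.1, by linarith, 0, ⟨le_rfl, hT⟩, by simpa [hσ0] using hD0,
        fun S hS e he => ?_⟩
      have h1 := hS.dist_add_dist he
      rw [hσ0, dist_self] at h1
      have h2 : c 0 = e := dist_le_zero.1 (by linarith [dist_nonneg (x := e) (y := c 0)])
      rw [← h2]
      exact hfar 0 ⟨le_rfl, hT⟩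
  have hright : ∃ t ∈ Icc 0 L, t₀ ≤ t ∧ t - t₀ ≤ 2 * D ∧ ∃ s ∈ Icc 0 T, dist (σ t) (c s) ≤ D ∧
      ∀ S, IsSegment (σ t) (c s) S → ∀ e ∈ S, D ≤ dist (σ t₀) e := by
    by_cases h : t₀ + 2 * D ≤ L
    · have hm : t₀ + 2 * D ∈ Icc 0 L := ⟨by linarith [ht₀.1], h⟩
      obtain ⟨s, hs, hsd⟩ := hnear (σ (t₀ + 2 * D))
      have hsD := hsd ▸ hmax' _ hm
      refine ⟨t₀ + 2 * D, hm, by linarith, by linarith, s, hs, hsD, fun S hS e he => ?_⟩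
      have h1 := hS.dist_add_dist he
      have h2 := hσ _ hm _ ht₀
      rw [add_sub_cancel_left, abs_of_nonneg (by linarith), dist_comm] at h2
      have h3 := dist_triangle (σ t₀) e (σ (t₀ + 2 * D))
      rw [dist_comm e] at h3
      linarith [dist_nonneg (x := e) (y := c s)]
    · refine ⟨L, ⟨hL, le_rfl⟩, ht₀.2, by linarith, T, ⟨hT, le_rfl⟩, by simpa [hσL] using hD0,
        fun S hS e he => ?_⟩
      have h1 := hS.dist_add_dist he
      rw [hσL, dist_self] at h1
      have h2 : c T = e := dist_le_zero.1 (by linarith [dist_nonneg (x := e) (y := c T)])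
      rw [← h2]
      exact hfar T ⟨hT, le_rfl⟩
  obtain ⟨t₁, ht₁, ht₁₀, hl₁, s₁, hs₁, hd₁, hf₁⟩ := hleft
  obtain ⟨t₂, ht₂, ht₂₀, hl₂, s₂, hs₂, hd₂, hf₂⟩ := hright
  -- Thin quadrilateral `σ t₁`, `c s₁`, `c s₂`, `σ t₂`: only the side between the curve points can
  -- be closer than `D` to `σ t₀`, up to `2 * δ`. Here `6 * D = D + 4 * D + D` bounds the distance
  -- of the two curve points.
  have hstep : ∀ k : ℕ, A * (6 * D) + C ≤ 2 ^ k → D ≤ (k + 2) * δ + 1 := by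
    intro k hk
    have hkδ : 0 ≤ (k : ℝ) * δ := by positivity
    have hlen : |s₁ - s₂| ≤ 2 ^ k := by
      refine (hq s₁ hs₁ s₂ hs₂).trans (le_trans ?_ hk)
      gcongr
      have h1 := dist_triangle4 (c s₁) (σ t₁) (σ t₂) (c s₂)
      rw [hσ _ ht₁ _ ht₂, abs_sub_comm, abs_of_nonneg (by linarith), dist_comm (c s₁) (σ t₁)] at h1
      linarith
    obtain ⟨S₁, hS₁⟩ := hg (σ t₁) (c s₁)
    obtain ⟨S₂, hS₂⟩ := hg (c s₁) (c s₂)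
    obtain ⟨S₃, hS₃⟩ := hg (σ t₂) (c s₂)
    obtain ⟨S₄, hS₄⟩ := hg (σ t₁) (c s₂)
    obtain ⟨b, hb, hab⟩ := hX _ _ _ _ _ _
      (isSegment_restrict hσ ht₁.1 (ht₁₀.trans ht₂₀) ht₂.2) hS₃ hS₄.symm (σ t₀)
      ⟨t₀, ⟨ht₁₀, ht₂₀⟩, rfl⟩
    rcases hb with hb | hb
    · have := hf₂ _ hS₃ b hb
      linarith
    · obtain ⟨e, he, hbe⟩ := hX _ _ _ _ _ _ hS₄ hS₂.symm hS₁.symm b hb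
      have htri := dist_triangle (σ t₀) b e
      rcases he with he | he
      · obtain ⟨u, hu, hue⟩ := hX.exists_dist_le_of_lipschitz hg hc hs₁ hs₂ hlen hS₂ he
        have h1 := dist_triangle (σ t₀) e (c u)
        have h2 := hfar u hu
        linarith
      · have := hf₁ _ hS₁ e he
        linarith
  by_contra! hcon
  obtain ⟨N, hN⟩ := exists_nat_ge (D / δ)
  -- Any a priori bound on `D` improves by `δ` at a time until `k₀` is reached.
  have hdown : ∀ j : ℕ, D ≤ (k₀ + j + 2) * δ + 1 → D ≤ (k₀ + 2) * δ + 1 := by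
    intro j
    induction j with
    | zero => intro h; simpa using h
    | succ j ih =>
      intro h
      refine ih ?_
      have := hstep (k₀ + j) (le_trans ?_ (hk₀ (k₀ + j) (by omega)))
      · push_cast at this; exact this
      · push_cast at h ⊢
        have h' : D ≤ (k₀ + j + 3) * δ + 1 := by linarith
        gcongr
  refine absurd (hdown N ?_) (not_le.2 hcon)
  rw [div_le_iff₀ hδ] at hN
  have : 0 ≤ ((k₀ : ℝ) + 2) * δ := by positivity
  linarith

end MetricGeometry

end

/-! ### The Poincaré distance and automorphisms of the disc -/

noncomputable section

namespace Kobayashi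

lemma half_le_artanh {x : ℝ} (h0 : 0 ≤ x) (h1 : x < 1) : x / 2 ≤ Real.artanh x := by
  rw [Real.artanh_eq_half_log ⟨by linarith, h1.le⟩]
  have h := Real.one_sub_inv_le_log_of_pos (x := (1 + x) / (1 - x))
    (div_pos (by linarith) (by linarith))
  have : x ≤ 1 - ((1 + x) / (1 - x))⁻¹ := by
    rw [inv_div, le_sub_comm, div_le_iff₀ (by linarith)]
    nlinarith
  linarith

lemma artanh_le_two_mul {x : ℝ} (h0 : 0 ≤ x) (h1 : x ≤ 1 / 2) : Real.artanh x ≤ 2 * x := by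
  rw [Real.artanh_eq_half_log ⟨by linarith, by linarith⟩]
  have h := Real.log_le_sub_one_of_pos (x := (1 + x) / (1 - x))
    (div_pos (by linarith) (by linarith))
  have : (1 + x) / (1 - x) ≤ 4 * x + 1 := by
    rw [div_le_iff₀ (by linarith)]
    nlinarith
  linarith

/-- Poincaré length is additive along a radius of the disc. -/
lemma artanh_sub {s t : ℝ} (hs : 0 ≤ s) (hst : s ≤ t) (ht : t < 1) :
    Real.artanh ((t - s) / (1 - s * t)) = Real.artanh t - Real.artanh s := by
  have h1 : 0 < 1 - s * t := by nlinarith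
  have h2 : (t - s) / (1 - s * t) ≤ 1 := by rw [div_le_one h1]; nlinarith
  have h0 : 0 ≤ (t - s) / (1 - s * t) := div_nonneg (by linarith) h1.le
  rw [Real.artanh_eq_half_log ⟨by linarith, h2⟩, Real.artanh_eq_half_log ⟨by linarith, ht.le⟩,
    Real.artanh_eq_half_log ⟨by linarith, by linarith⟩, ← mul_sub, ← Real.log_div]
  · congr 2
    have hne : 1 - s * t ≠ 0 := h1.ne'
    have : 1 - t ≠ 0 := by linarith
    have : 1 - s ≠ 0 := by linarith
    have : 1 + s ≠ 0 := by linarith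
    have h5 : (1 - (t - s) / (1 - s * t)) = (1 - t) * (1 + s) / (1 - s * t) := by
      rw [one_sub_div hne]; ring
    have h6 : (1 + (t - s) / (1 - s * t)) = (1 + t) * (1 - s) / (1 - s * t) := by
      rw [one_add_div hne]; ring
    rw [h5, h6, div_div_div_cancel_right₀ hne]
    field_simp
  · have := div_pos (show 0 < 1 + t by linarith) (show 0 < 1 - t by linarith)
    exact this.ne'
  · have := div_pos (show 0 < 1 + s by linarith) (show 0 < 1 - s by linarith)
    exact this.ne'

lemma poincareDist_comm (a b : ℂ) : poincareDist a b = poincareDist b a := by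
  unfold poincareDist
  congr 1
  rw [norm_div, norm_div, norm_sub_rev, ← Complex.norm_conj (1 - conj b * a)]
  simp [mul_comm]

lemma poincareDist_zero_left (a : ℂ) : poincareDist 0 a = Real.artanh ‖a‖ := by
  simp [poincareDist]

lemma poincareDist_ofReal {s t : ℝ} (hs : 0 ≤ s) (hst : s ≤ t) (ht : t < 1) :
    poincareDist s t = Real.artanh t - Real.artanh s := by
  have h1 : 0 < 1 - s * t := by nlinarith
  rw [← artanh_sub hs hst ht, poincareDist_comm, poincareDist]
  congr 1
  rw [Complex.conj_ofReal, ← Complex.ofReal_sub, ← Complex.ofReal_mul, ← Complex.ofReal_one,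
    ← Complex.ofReal_sub, ← Complex.ofReal_div, Complex.norm_real, Real.norm_of_nonneg]
  exact div_nonneg (by linarith) h1.le

/-- The automorphism `ζ ↦ (ζ + a) / (1 + conj a * ζ)` of the disc. -/
def moebius (a ζ : ℂ) : ℂ := (ζ + a) / (1 + conj a * ζ)

lemma normSq_lt_one_of_mem_disc {a : ℂ} (ha : a ∈ disc) : Complex.normSq a < 1 := by
  rw [disc, mem_ball_zero_iff] at ha
  rw [Complex.normSq_eq_norm_sq]
  nlinarith [norm_nonneg a]

lemma one_add_conj_mul_ne_zero {a ζ : ℂ} (ha : a ∈ disc) (hζ : ζ ∈ disc) :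
    1 + conj a * ζ ≠ 0 := by
  rw [disc, mem_ball_zero_iff] at ha hζ
  intro h
  have : ‖conj a * ζ‖ = 1 := by rw [eq_neg_of_add_eq_zero_right h]; simp
  rw [norm_mul, Complex.norm_conj] at this
  nlinarith [norm_nonneg a, norm_nonneg ζ]

lemma differentiableOn_moebius {a : ℂ} (ha : a ∈ disc) : DifferentiableOn ℂ (moebius a) disc :=
  DifferentiableOn.div (by fun_prop) (by fun_prop) fun _ hζ => one_add_conj_mul_ne_zero ha hζ

lemma mapsTo_moebius {a : ℂ} (ha : a ∈ disc) : MapsTo (moebius a) disc disc := by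
  intro ζ hζ
  have h0 := one_add_conj_mul_ne_zero ha hζ
  have h1 := normSq_lt_one_of_mem_disc ha
  have h2 := normSq_lt_one_of_mem_disc hζ
  rw [disc, mem_ball_zero_iff, moebius, norm_div, div_lt_one (norm_pos_iff.2 h0)]
  refine lt_of_pow_lt_pow_left₀ 2 (norm_nonneg _) ?_
  rw [← Complex.normSq_eq_norm_sq, ← Complex.normSq_eq_norm_sq]
  simp only [Complex.normSq_apply, Complex.add_re, Complex.add_im, Complex.mul_re,
    Complex.mul_im, Complex.conj_re, Complex.conj_im, Complex.one_re, Complex.one_im] at h1 h2 ⊢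
  -- The identity `|1 + conj a * ζ|² - |ζ + a|² = (1 - |a|²) * (1 - |ζ|²)`.
  nlinarith [mul_pos (sub_pos.2 h1) (sub_pos.2 h2)]

lemma zero_mem_disc : (0 : ℂ) ∈ disc := by simp [disc]

lemma ofReal_mem_disc {t : ℝ} (h0 : 0 ≤ t) (h1 : t < 1) : (t : ℂ) ∈ disc := by
  simpa [disc, abs_of_nonneg h0] using h1

/-! ### The Lempert function and the Kobayashi pseudodistance -/

variable {d : ℕ} {X Y : Set (Cn d)} {z w m : Cn d}

lemma lempert_le {f : ℂ → Cn d} {a b : ℂ} (hf : DifferentiableOn ℂ f disc)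
    (hX : MapsTo f disc X) (ha : a ∈ disc) (hb : b ∈ disc) :
    lempert X (f a) (f b) ≤ ENNReal.ofReal (poincareDist a b) :=
  (iInf₂_le f a).trans <| (iInf₂_le b hf).trans <| (iInf₂_le hX ha).trans <|
    (iInf_le _ hb).trans <| (iInf_le _ rfl).trans <| iInf_le _ rfl

lemma lempert_lt_iff {r : ℝ≥0∞} : lempert X z w < r ↔ ∃ (f : ℂ → Cn d) (a b : ℂ),
    DifferentiableOn ℂ f disc ∧ MapsTo f disc X ∧ a ∈ disc ∧ b ∈ disc ∧ f a = z ∧ f b = w ∧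
      ENNReal.ofReal (poincareDist a b) < r := by
  simp only [lempert, iInf_lt_iff, exists_prop]

lemma lempert_comm (X : Set (Cn d)) (z w : Cn d) : lempert X z w = lempert X w z := by
  have h : ∀ z w, lempert X z w ≤ lempert X w z := fun z w => by
    refine le_of_forall_gt fun r hr => ?_
    obtain ⟨f, a, b, hf, hX, ha, hb, rfl, rfl, h⟩ := lempert_lt_iff.1 hr
    refine (lempert_le hf hX hb ha).trans_lt ?_
    rwa [poincareDist_comm]
  exact le_antisymm (h z w) (h w z)

/-- The disc realizing `lempert X z w < r` may be normalized so that it sends `0` to `z` and a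
nonnegative real number to `w`. -/
lemma exists_disc_of_lempert_lt {r : ℝ≥0∞} (h : lempert X z w < r) :
    ∃ (g : ℂ → Cn d) (t : ℝ), DifferentiableOn ℂ g disc ∧ MapsTo g disc X ∧ 0 ≤ t ∧ t < 1 ∧
      g 0 = z ∧ g t = w ∧ ENNReal.ofReal (Real.artanh t) < r := by
  obtain ⟨f, a, b, hf, hX, ha, hb, rfl, rfl, h⟩ := lempert_lt_iff.1 h
  have hna : -a ∈ disc := by simpa [disc] using ha
  set ζ := moebius (-a) b with hζ
  have hζd : ζ ∈ disc := mapsTo_moebius hna hb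
  have hnorm : ‖ζ‖ = ‖(a - b) / (1 - conj b * a)‖ := by
    rw [hζ, moebius, norm_div, norm_div, ← sub_eq_add_neg, norm_sub_rev,
      ← Complex.norm_conj (1 - conj b * a)]
    simp [mul_comm, sub_eq_add_neg]
  obtain ⟨u, hu, huζ⟩ : ∃ u : ℂ, ‖u‖ = 1 ∧ ζ = u * (‖ζ‖ : ℝ) := by
    rcases eq_or_ne ζ 0 with h | h
    · exact ⟨1, by simp, by simp [h]⟩
    · have h' : (‖ζ‖ : ℂ) ≠ 0 := by simpa using h
      exact ⟨ζ / ‖ζ‖, by simp [h], by field_simp⟩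
  have hrot : MapsTo (fun ξ : ℂ => u * ξ) disc disc := fun ξ hξ => by
    simpa [disc, hu] using hξ
  have hb' : moebius a ζ = b := by
    have h1 := one_add_conj_mul_ne_zero hna hb
    have h2 := one_add_conj_mul_ne_zero ha hζd
    have h3 : ζ * (1 + conj (-a) * b) = b + -a := by rw [hζ, moebius, div_mul_cancel₀ _ h1]
    rw [map_neg] at h3
    rw [moebius, div_eq_iff h2]
    linear_combination h3
  refine ⟨fun ξ => f (moebius a (u * ξ)), ‖ζ‖, ?_, ?_, norm_nonneg _, ?_, ?_, ?_, ?_⟩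
  · exact hf.comp ((differentiableOn_moebius ha).comp (by fun_prop) hrot)
      ((mapsTo_moebius ha).comp hrot)
  · exact fun ξ hξ => hX (mapsTo_moebius ha (hrot hξ))
  · simpa [disc] using hζd
  · simp [moebius]
  · simp only [← huζ, hb']
  · rwa [hnorm]

lemma lempert_disc_le {g : ℂ → Cn d} (hg : DifferentiableOn ℂ g disc) (hX : MapsTo g disc X)
    {s t : ℝ} (hs : 0 ≤ s) (hst : s ≤ t) (ht : t < 1) :
    lempert X (g s) (g t) ≤ ENNReal.ofReal (Real.artanh t - Real.artanh s) := by
  rw [← poincareDist_ofReal hs hst ht]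
  exact lempert_le hg hX (ofReal_mem_disc hs (hst.trans_lt ht))
    (ofReal_mem_disc (hs.trans hst) ht)

lemma lempert_zero_le {g : ℂ → Cn d} (hg : DifferentiableOn ℂ g disc) (hX : MapsTo g disc X)
    {ζ : ℂ} (hζ : ζ ∈ disc) : lempert X (g 0) (g ζ) ≤ ENNReal.ofReal (Real.artanh ‖ζ‖) := by
  rw [← poincareDist_zero_left]
  exact lempert_le hg hX zero_mem_disc hζ

/-- By homogeneity of the disc, lower bounds need checking only on normalized discs. -/
lemma le_lempert {e : Cn d → Cn d → ℝ≥0∞}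
    (h : ∀ (g : ℂ → Cn d) (t : ℝ), DifferentiableOn ℂ g disc → MapsTo g disc X → 0 ≤ t → t < 1 →
      e (g 0) (g t) ≤ ENNReal.ofReal (Real.artanh t)) (z w : Cn d) : e z w ≤ lempert X z w := by
  refine le_of_forall_gt fun r hr => ?_
  obtain ⟨g, t, hg, hX, h0, h1, rfl, rfl, hlt⟩ := exists_disc_of_lempert_lt hr
  exact (h g t hg hX h0 h1).trans_lt hlt

lemma lempert_mono (h : X ⊆ Y) (z w : Cn d) : lempert Y z w ≤ lempert X z w := by
  refine le_of_forall_gt fun r hr => ?_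
  obtain ⟨f, a, b, hf, hX, ha, hb, rfl, rfl, hlt⟩ := lempert_lt_iff.1 hr
  exact (lempert_le hf (hX.mono_right h) ha hb).trans_lt hlt

lemma kob_le_sum {n : ℕ} {c : ℕ → Cn d} (h0 : c 0 = z) (hn : c n = w) :
    kob X z w ≤ ∑ i ∈ Finset.range n, lempert X (c i) (c (i + 1)) :=
  (iInf₂_le n c).trans <| (iInf_le _ h0).trans <| iInf_le _ hn

lemma kob_lt_iff {r : ℝ≥0∞} : kob X z w < r ↔ ∃ (n : ℕ) (c : ℕ → Cn d), c 0 = z ∧ c n = w ∧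
    ∑ i ∈ Finset.range n, lempert X (c i) (c (i + 1)) < r := by
  simp only [kob, iInf_lt_iff, exists_prop]

@[simp] lemma kob_self (X : Set (Cn d)) (z : Cn d) : kob X z z = 0 := by
  have := kob_le_sum (X := X) (n := 0) (c := fun _ => z) rfl rfl
  simpa using this

lemma kob_le_lempert (X : Set (Cn d)) (z w : Cn d) : kob X z w ≤ lempert X z w := by
  have := kob_le_sum (X := X) (z := z) (w := w) (n := 1) (c := fun i => if i = 0 then z else w)
    (by simp) (by simp)
  simpa using this

lemma kob_triangle (X : Set (Cn d)) (z m w : Cn d) : kob X z w ≤ kob X z m + kob X m w := by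
  refine le_of_forall_gt fun r hr => ?_
  rw [← lt_tsub_iff_right] at hr
  obtain ⟨n, c, h0, hn, hc⟩ := kob_lt_iff.1 hr
  rw [lt_tsub_iff_right, ← lt_tsub_iff_left] at hc
  obtain ⟨n', c', h0', hn', hc'⟩ := kob_lt_iff.1 hc
  rw [lt_tsub_iff_left] at hc'
  refine (kob_le_sum (n := n + n') (c := fun i => if i ≤ n then c i else c' (i - n)) (by simpa)
    ?_).trans_lt (lt_of_le_of_lt (le_of_eq ?_) hc')
  · rcases Nat.eq_zero_or_pos n' with rfl | h
    · simp [hn, ← hn', h0']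
    · simp [h.ne', hn']
  · rw [Finset.sum_range_add]
    congr 1
    · refine Finset.sum_congr rfl fun i hi => ?_
      have := Finset.mem_range.1 hi
      simp [this.le, Nat.succ_le_of_lt this]
    · refine Finset.sum_congr rfl fun i _ => ?_
      rcases Nat.eq_zero_or_pos i with rfl | h
      · simp [hn, h0']
      · simp [h.ne', add_assoc]

lemma kob_comm (X : Set (Cn d)) (z w : Cn d) : kob X z w = kob X w z := by
  have h : ∀ z w, kob X z w ≤ kob X w z := fun z w => by
    refine le_of_forall_gt fun r hr => ?_
    obtain ⟨n, c, h0, hn, hc⟩ := kob_lt_iff.1 hr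
    refine (kob_le_sum (n := n) (c := fun i => c (n - i)) (by simpa) (by simpa)).trans_lt
      (lt_of_le_of_lt (le_of_eq ?_) hc)
    rw [← Finset.sum_range_reflect]
    refine Finset.sum_congr rfl fun i hi => ?_
    have := Finset.mem_range.1 hi
    rw [lempert_comm]
    congr 2 <;> omega
  exact le_antisymm (h z w) (h w z)

/-- `kob X` is the greatest pseudodistance bounded by the Lempert function. -/
lemma le_kob {e : Cn d → Cn d → ℝ≥0∞} (h0 : ∀ z, e z z = 0)
    (htri : ∀ z m w, e z w ≤ e z m + e m w) (hle : ∀ z w, e z w ≤ lempert X z w) (z w : Cn d) :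
    e z w ≤ kob X z w := by
  refine le_of_forall_gt fun r hr => ?_
  obtain ⟨n, c, rfl, rfl, hc⟩ := kob_lt_iff.1 hr
  refine lt_of_le_of_lt ?_ hc
  clear hc hr
  induction n with
  | zero => simp [h0]
  | succ n ih =>
    rw [Finset.sum_range_succ]
    exact (htri _ (c n) _).trans (add_le_add ih (hle _ _))

lemma kob_mono (h : X ⊆ Y) (z w : Cn d) : kob Y z w ≤ kob X z w :=
  le_kob (kob_self Y) (kob_triangle Y)
    (fun z w => (kob_le_lempert Y z w).trans (lempert_mono h z w)) z w

lemma kob_le_of_mem_ball {r : ℝ} (hX : Metric.ball z r ⊆ X) (hw : w ∈ Metric.ball z r) :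
    kob X z w ≤ ENNReal.ofReal (Real.artanh (dist w z / r)) := by
  rcases eq_or_ne w z with rfl | hwz
  · simp
  have hr : 0 < r := Metric.pos_of_mem_ball hw
  have hd : 0 < dist w z := dist_pos.2 hwz
  have hg : DifferentiableOn ℂ (fun ζ : ℂ => z + (ζ * (r / dist w z : ℝ)) • (w - z)) disc := by
    fun_prop
  have hmaps : MapsTo (fun ζ : ℂ => z + (ζ * (r / dist w z : ℝ)) • (w - z)) disc X := by
    intro ζ hζ
    refine hX ?_
    rw [disc, mem_ball_zero_iff] at hζ
    rw [Metric.mem_ball, dist_eq_norm, add_sub_cancel_left, norm_smul, norm_mul,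
      Complex.norm_real, Real.norm_of_nonneg (by positivity), ← dist_eq_norm]
    calc _ = ‖ζ‖ * r := by field_simp
      _ < 1 * r := by gcongr
      _ = r := one_mul r
  have ht : dist w z / r < 1 := (div_lt_one hr).2 hw
  have := lempert_zero_le hg hmaps (ofReal_mem_disc (by positivity) ht)
  refine (kob_le_lempert _ _ _).trans ?_
  rw [Complex.norm_real, Real.norm_of_nonneg (by positivity)] at this
  rw [← Complex.ofReal_mul, show dist w z / r * (r / dist w z) = 1 by field_simp] at this
  simpa using this

lemma kob_le_of_dist_le {r : ℝ} (hr : 0 < r) (hX : Metric.ball z r ⊆ X) (hw : dist w z ≤ r / 2) :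
    kob X z w ≤ ENNReal.ofReal (2 / r * dist w z) := by
  refine (kob_le_of_mem_ball hX (Metric.mem_ball.2 (by linarith))).trans
    (ENNReal.ofReal_le_ofReal ?_)
  refine (artanh_le_two_mul (by positivity) ?_).trans_eq (by ring)
  rw [div_le_iff₀ hr]; linarith

lemma tendsto_kob_nhds (hX : IsOpen X) (hz : z ∈ X) : Tendsto (kob X z) (𝓝 z) (𝓝 0) := by
  obtain ⟨r, hr, hrX⟩ := Metric.isOpen_iff.1 hX z hz
  have h1 : Tendsto (fun w => ENNReal.ofReal (2 / r * dist w z)) (𝓝 z) (𝓝 0) := by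
    have : Continuous fun w => ENNReal.ofReal (2 / r * dist w z) :=
      ENNReal.continuous_ofReal.comp (by fun_prop)
    simpa using this.tendsto z
  refine tendsto_of_tendsto_of_tendsto_of_le_of_le' tendsto_const_nhds h1
    (Eventually.of_forall fun _ => zero_le) ?_
  filter_upwards [Metric.closedBall_mem_nhds z (half_pos hr)] with w hw
  exact kob_le_of_dist_le hr hrX hw

lemma continuousOn_kob (hX : IsOpen X) (z : Cn d) : ContinuousOn (kob X z) X := by
  intro v hv
  refine ContinuousAt.continuousWithinAt (tendsto_order.2 ⟨fun a ha => ?_, fun b hb => ?_⟩)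
  · filter_upwards [(tendsto_kob_nhds hX hv).eventually (gt_mem_nhds (tsub_pos_of_lt ha))]
      with u hu
    rw [lt_tsub_iff_right] at hu
    have := hu.trans_le (kob_triangle X z u v)
    rw [kob_comm X u v, add_comm (kob X z u)] at this
    exact lt_of_add_lt_add_left this
  · filter_upwards [(tendsto_kob_nhds hX hv).eventually (gt_mem_nhds (tsub_pos_of_lt hb))]
      with u hu
    rw [lt_tsub_iff_left] at hu
    exact (kob_triangle X z v u).trans_lt hu

lemma kob_ne_top (hX : IsOpen X) (hc : IsPreconnected X) (hz : z ∈ X) (hw : w ∈ X) :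
    kob X z w ≠ ∞ := by
  refine hc.induction₂ (fun z w => kob X z w ≠ ∞) (fun x hx => ?_) (fun x y z _ _ _ h1 h2 => ?_)
    (fun x y _ _ h => by rwa [kob_comm]) hz hw
  · filter_upwards [nhdsWithin_le_nhds ((tendsto_kob_nhds hX hx).eventually
      (gt_mem_nhds zero_lt_one))] with y hy
    exact (hy.trans ENNReal.one_lt_top).ne
  · exact ne_top_of_le_ne_top (ENNReal.add_ne_top.2 ⟨h1, h2⟩) (kob_triangle X x y z)

/-- On bounded sets, the Kobayashi pseudodistance dominates the Euclidean distance. -/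
lemma exists_mul_dist_le_kob (hb : Bornology.IsBounded X) :
    ∃ c : ℝ, 0 < c ∧ ∀ z w, ENNReal.ofReal (c * dist z w) ≤ kob X z w := by
  obtain ⟨R, hR, hXR⟩ := hb.subset_closedBall_lt 0 0
  refine ⟨1 / (4 * R), by positivity, le_kob (by simp) (fun z m w => ?_) (le_lempert ?_)⟩
  · rw [← ENNReal.ofReal_add (by positivity) (by positivity), ← mul_add]
    gcongr
    exact dist_triangle z m w
  · intro g t hg hX h0 h1
    gcongr
    -- The Schwarz lemma in this ball gives `dist ≤ 2 * R * t`, and `t ≤ 2 * artanh t`; hence the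
    -- constant `4 * R`.
    have hmaps : MapsTo g (Metric.ball 0 1) (Metric.closedBall (g 0) (2 * R)) := fun ζ hζ => by
      have h1 := hXR (hX hζ)
      have h2 := hXR (hX zero_mem_disc)
      rw [Metric.mem_closedBall] at *
      linarith [dist_triangle_right (g ζ) (g 0) 0]
    have := Complex.dist_le_div_mul_dist_of_mapsTo_ball hg hmaps (ofReal_mem_disc h0 h1)
    rw [div_one, dist_zero_right, Complex.norm_real, Real.norm_of_nonneg h0, dist_comm] at this
    have h3 := half_le_artanh h0 h1
    rw [one_div, inv_mul_le_iff₀ (by positivity)]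
    nlinarith

/-- The set is the image of a radius, along which the Poincaré length is additive. -/
lemma exists_isPreconnected_of_lempert_lt {r : ℝ≥0∞} (h : lempert X z w < r) :
    ∃ C ⊆ X, IsPreconnected C ∧ z ∈ C ∧ w ∈ C ∧ ∀ m ∈ C, kob X z m + kob X m w < r := by
  obtain ⟨g, t, hg, hX, h0, h1, rfl, rfl, hr⟩ := exists_disc_of_lempert_lt h
  have hmem : ∀ s ∈ Icc 0 t, (s : ℂ) ∈ disc := fun s hs => ofReal_mem_disc hs.1 (hs.2.trans_lt h1)
  refine ⟨(fun s : ℝ => g s) '' Icc 0 t, ?_, ?_, ⟨0, ⟨le_rfl, h0⟩, by simp⟩,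
    ⟨t, ⟨h0, le_rfl⟩, rfl⟩, ?_⟩
  · rintro _ ⟨s, hs, rfl⟩
    exact hX (hmem s hs)
  · exact isPreconnected_Icc.image _
      (hg.continuousOn.comp Complex.continuous_ofReal.continuousOn hmem)
  · rintro _ ⟨s, hs, rfl⟩
    have e1 := (kob_le_lempert X _ _).trans (lempert_disc_le hg hX le_rfl hs.1 (hs.2.trans_lt h1))
    have e2 := (kob_le_lempert X _ _).trans (lempert_disc_le hg hX hs.1 hs.2 h1)
    rw [Real.artanh_zero, sub_zero, Complex.ofReal_zero] at e1
    refine (add_le_add e1 e2).trans_lt ?_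
    rw [← ENNReal.ofReal_add (Real.artanh_nonneg hs.1)
      (sub_nonneg.2 (Real.artanh_le_artanh (by linarith [hs.1]) h1 hs.2))]
    simpa using hr

/-- Points at small Kobayashi distance are joined by a connected set which is almost metrically
convex. -/
lemma exists_isPreconnected_of_kob_lt {r : ℝ≥0∞} (hz : z ∈ X) (h : kob X z w < r) :
    ∃ C ⊆ X, IsPreconnected C ∧ z ∈ C ∧ w ∈ C ∧ ∀ m ∈ C, kob X z m + kob X m w < r := by
  obtain ⟨n, c, rfl, rfl, hc⟩ := kob_lt_iff.1 h
  clear h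
  induction n generalizing c r with
  | zero =>
    refine ⟨{c 0}, by simpa, isPreconnected_singleton, rfl, rfl, ?_⟩
    rintro m rfl
    simpa using hc
  | succ n ih =>
    rw [Finset.sum_range_succ'] at hc
    have hrest : kob X (c 1) (c (n + 1)) ≤
        ∑ i ∈ Finset.range n, lempert X (c (i + 1)) (c (i + 1 + 1)) :=
      kob_le_sum (c := fun i => c (i + 1)) rfl rfl
    have h1 := lt_tsub_iff_left.2 hc
    obtain ⟨C, hCX, hC, hC0, hC1, hCd⟩ := exists_isPreconnected_of_lempert_lt h1
    obtain ⟨C', hCX', hC', hC0', hC1', hCd'⟩ := ih (c := fun i => c (i + 1)) (hCX hC1)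
      (lt_tsub_iff_right.2 hc)
    refine ⟨C ∪ C', union_subset hCX hCX', hC.union (c 1) hC1 hC0' hC', Or.inl hC0, Or.inr hC1',
      fun m hm => ?_⟩
    rcases hm with hm | hm
    · have := hCd m hm
      rw [lt_tsub_iff_right] at this
      refine lt_of_le_of_lt ?_ this
      rw [add_assoc]
      gcongr
      exact (kob_triangle X m (c 1) _).trans (by gcongr)
    · have := hCd' m hm
      rw [lt_tsub_iff_left] at this
      refine lt_of_le_of_lt ?_ this
      rw [← add_assoc]
      gcongr
      refine (kob_triangle X _ (c 1) m).trans ?_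
      gcongr
      exact kob_le_lempert _ _ _

/-- Intermediate value theorem for `kob X z` on an almost convex connected set from `z` to `w`: this
makes the Kobayashi distance a length metric. -/
lemma exists_kob_le_of_kob_lt_add (hX : IsOpen X) (hz : z ∈ X) (hw : w ∈ X) {a b : ℝ≥0∞}
    (h : kob X z w < a + b) : ∃ m ∈ X, kob X z m ≤ a ∧ kob X m w ≤ b := by
  obtain ⟨C, hCX, hC, hC0, hC1, hCd⟩ := exists_isPreconnected_of_kob_lt hz h
  rcases le_total (kob X z w) a with hle | hle
  · exact ⟨w, hw, hle, by simp⟩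
  obtain ⟨m, hm, hma⟩ := hC.intermediate_value hC0 hC1 ((continuousOn_kob hX z).mono hCX)
    ⟨by simp, hle⟩
  refine ⟨m, hCX hm, hma.le, ?_⟩
  have := hCd m hm
  rw [hma] at this
  exact (lt_of_add_lt_add_left this).le

end Kobayashi

end

/-! ### Bounded domains as metric spaces; uniform visibility -/

noncomputable section

namespace Kobayashi

open MetricGeometry

variable {d : ℕ}

/-- A bounded domain in `ℂ^d`. -/
structure BoundedDomain (d : ℕ) where
  /-- the underlying set -/
  carrier : Set (Cn d)
  isOpen : IsOpen carrier
  isConnected : IsConnected carrier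
  isBounded : Bornology.IsBounded carrier

/-- The points of a bounded domain, as a type to be endowed with the Kobayashi distance. -/
@[ext]
structure BoundedDomain.Pt (D : BoundedDomain d) where
  /-- the underlying point of `ℂ^d` -/
  val : Cn d
  property : val ∈ D.carrier

namespace BoundedDomain

variable (D : BoundedDomain d)

lemma kob_ne_top {z w : Cn d} (hz : z ∈ D.carrier) (hw : w ∈ D.carrier) :
    kob D.carrier z w ≠ ∞ :=
  Kobayashi.kob_ne_top D.isOpen D.isConnected.isPreconnected hz hw

instance : MetricSpace D.Pt where
  dist z w := (kob D.carrier z.val w.val).toReal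
  dist_self z := by simp
  dist_comm z w := by rw [kob_comm]
  dist_triangle x y z := by
    rw [← ENNReal.toReal_add (D.kob_ne_top x.2 y.2) (D.kob_ne_top y.2 z.2)]
    exact ENNReal.toReal_mono
      (ENNReal.add_ne_top.2 ⟨D.kob_ne_top x.2 y.2, D.kob_ne_top y.2 z.2⟩) (kob_triangle _ _ _ _)
  eq_of_dist_eq_zero {x y} h := by
    obtain ⟨c, hc, hcd⟩ := exists_mul_dist_le_kob D.isBounded
    have h0 : kob D.carrier x.val y.val = 0 :=
      (ENNReal.toReal_eq_zero_iff _).1 h |>.resolve_right (D.kob_ne_top x.2 y.2)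
    have := hcd x.val y.val
    rw [h0, nonpos_iff_eq_zero, ENNReal.ofReal_eq_zero] at this
    exact Pt.ext (dist_le_zero.1 (nonpos_of_mul_nonpos_right this hc))

variable {D}

lemma ofReal_dist (z w : D.Pt) : ENNReal.ofReal (dist z w) = kob D.carrier z.val w.val :=
  ENNReal.ofReal_toReal (D.kob_ne_top z.2 w.2)

lemma dist_eq_iff {z w : D.Pt} {r : ℝ} (hr : 0 ≤ r) :
    dist z w = r ↔ kob D.carrier z.val w.val = ENNReal.ofReal r := by
  rw [← ofReal_dist, ENNReal.ofReal_eq_ofReal_iff dist_nonneg hr]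

lemma dist_le_iff {z w : D.Pt} {r : ℝ} (hr : 0 ≤ r) :
    dist z w ≤ r ↔ kob D.carrier z.val w.val ≤ ENNReal.ofReal r := by
  rw [← ofReal_dist, ENNReal.ofReal_le_ofReal_iff hr]

/-- The Kobayashi topology is the Euclidean one: the distance dominates a multiple of the Euclidean
distance and is continuous. -/
lemma isOpenEmbedding_val : IsOpenEmbedding (Pt.val : D.Pt → Cn d) := by
  refine .of_continuous_injective_isOpenMap ?_ (fun x y h => Pt.ext h)
    (IsOpenMap.of_nhds_le fun z s hs => ?_)
  · obtain ⟨c, hc, hcd⟩ := exists_mul_dist_le_kob D.isBounded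
    lift c to NNReal using hc.le
    refine (LipschitzWith.of_dist_le_mul (K := c⁻¹) fun x y => ?_).continuous
    have := hcd x.val y.val
    rw [← ofReal_dist, ENNReal.ofReal_le_ofReal_iff dist_nonneg] at this
    rw [NNReal.coe_inv, le_inv_mul_iff₀ hc]
    exact this
  · obtain ⟨ε, hε, hεs⟩ := Metric.mem_nhds_iff.1 (mem_map.1 hs)
    filter_upwards [(tendsto_kob_nhds D.isOpen z.2).eventually
      (gt_mem_nhds (ENNReal.ofReal_pos.2 hε)), D.isOpen.mem_nhds z.2] with w hw hwD
    refine hεs (show (⟨w, hwD⟩ : D.Pt) ∈ _ from ?_)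
    rw [Metric.mem_ball']
    rwa [← ENNReal.ofReal_lt_ofReal_iff hε, ofReal_dist]

instance : LocallyCompactSpace D.Pt := isOpenEmbedding_val.locallyCompactSpace

lemma completeSpace (h : IsCompleteHyperbolic D.carrier) : CompleteSpace D.Pt := by
  refine Metric.complete_of_cauchySeq_tendsto fun u hu => ?_
  obtain ⟨z, hz, hlim⟩ := h.2 (fun n => (u n).val) (fun n => (u n).2) fun ε hε => by
    obtain ⟨r, hr0, hr, hrε⟩ : ∃ r : ℝ, 0 ≤ r ∧ 0 < ENNReal.ofReal r ∧ ENNReal.ofReal r < ε := by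
      obtain ⟨r, hr, h1, h2⟩ := ENNReal.lt_iff_exists_real_btwn.1 hε
      exact ⟨r, hr, h1, h2⟩
    rw [ENNReal.ofReal_pos] at hr
    obtain ⟨N, hN⟩ := Metric.cauchySeq_iff.1 hu r hr
    refine ⟨N, fun m hm n hn => lt_of_le_of_lt ?_ hrε⟩
    rw [← ofReal_dist]
    exact ENNReal.ofReal_le_ofReal (hN m hm n hn).le
  refine ⟨⟨z, hz⟩, tendsto_iff_dist_tendsto_zero.2 ?_⟩
  have := (ENNReal.tendsto_toReal ENNReal.zero_ne_top).comp hlim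
  exact this

variable (D) in
lemma isLengthMetric : IsLengthMetric D.Pt := by
  intro x y a b ha hb h
  have h' : kob D.carrier x.val y.val < ENNReal.ofReal a + ENNReal.ofReal b := by
    rw [← ofReal_dist, ← ENNReal.ofReal_add ha hb]
    exact (ENNReal.ofReal_lt_ofReal_iff (dist_nonneg.trans_lt h)).2 h
  obtain ⟨m, hm, h1, h2⟩ := exists_kob_le_of_kob_lt_add D.isOpen x.2 y.2 h'
  exact ⟨⟨m, hm⟩, (dist_le_iff ha).2 h1, (dist_le_iff hb).2 h2⟩

lemma isGeodesicSegment_image {x y : D.Pt} {S : Set D.Pt} (h : IsSegment x y S) :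
    IsGeodesicSegment D.carrier x.val y.val (Pt.val '' S) := by
  obtain ⟨L, γ, hL, rfl, rfl, hd, rfl⟩ := h
  exact ⟨L, fun t => (γ t).val, hL, fun t _ => (γ t).2, rfl, rfl,
    fun s hs t ht => (dist_eq_iff (abs_nonneg _)).1 (hd s hs t ht), by rw [image_image]⟩

lemma hasThinTriangles (h : IsGromovHyperbolic D.carrier) :
    ∃ δ : ℝ, 0 < δ ∧ HasThinTriangles D.Pt δ := by
  obtain ⟨δ, hδ, h⟩ := h
  refine ⟨δ, hδ, fun x y z S₁ S₂ S₃ h₁ h₂ h₃ a ha => ?_⟩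
  obtain ⟨b, hb, hab⟩ := h x.val x.2 y.val y.2 z.val z.2 _ _ _ (isGeodesicSegment_image h₁)
    (isGeodesicSegment_image h₂) (isGeodesicSegment_image h₃) a.val ⟨a, ha, rfl⟩
  rw [← image_union] at hb
  obtain ⟨b, hb, rfl⟩ := hb
  exact ⟨b, hb, (dist_le_iff hδ.le).2 hab⟩

end BoundedDomain

/-- In a visible set, the visibility condition holds uniformly for pairs of points of two disjoint
compact sets. -/
lemma IsVisible.exists_isCompact {Ω : Set (Cn d)} (ho : IsOpen Ω) (h : IsVisible Ω)
    {A B : Set (Cn d)} (hA : IsCompact A) (hB : IsCompact B) (hAB : Disjoint A B) :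
    ∃ K ⊆ Ω, IsCompact K ∧ ∀ x ∈ A ∩ Ω, ∀ y ∈ B ∩ Ω, ∀ S, IsGeodesicSegment Ω x y S →
      (S ∩ K).Nonempty := by
  suffices H : ∃ K ⊆ Ω, IsCompact K ∧ ∀ p ∈ A ×ˢ B, p.1 ∈ Ω → p.2 ∈ Ω → ∀ S,
      IsGeodesicSegment Ω p.1 p.2 S → (S ∩ K).Nonempty by
    obtain ⟨K, hK, hKc, H⟩ := H
    exact ⟨K, hK, hKc, fun x hx y hy S hS => H (x, y) ⟨hx.1, hy.1⟩ hx.2 hy.2 S hS⟩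
  refine (hA.prod hB).induction_on (p := fun s => ∃ K ⊆ Ω, IsCompact K ∧ ∀ p ∈ s, p.1 ∈ Ω →
    p.2 ∈ Ω → ∀ S, IsGeodesicSegment Ω p.1 p.2 S → (S ∩ K).Nonempty) ?_ ?_ ?_ ?_
  · exact ⟨∅, empty_subset _, isCompact_empty, by simp⟩
  · rintro s t hst ⟨K, hK, hKc, H⟩
    exact ⟨K, hK, hKc, fun p hp => H p (hst hp)⟩
  · rintro s t ⟨K, hK, hKc, H⟩ ⟨K', hK', hKc', H'⟩
    refine ⟨K ∪ K', union_subset hK hK', hKc.union hKc', fun p hp h1 h2 S hS => ?_⟩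
    rcases hp with hp | hp
    · exact (H p hp h1 h2 S hS).mono (inter_subset_inter_right _ subset_union_left)
    · exact (H' p hp h1 h2 S hS).mono (inter_subset_inter_right _ subset_union_right)
  rintro ⟨a, b⟩ ⟨ha, hb⟩
  have hint : ∀ c ∈ Ω, ∃ K ⊆ Ω, IsCompact K ∧ K ∈ 𝓝 c := fun c hc => by
    obtain ⟨K, hK, hcK, hKΩ⟩ := exists_compact_subset ho hc
    exact ⟨K, hKΩ, hK, mem_interior_iff_mem_nhds.1 hcK⟩
  -- If `a` or `b` is inside `Ω`, a compact neighbourhood already catches an end point; outside the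
  -- closure there is nothing to prove. Only boundary pairs use visibility.
  by_cases haΩ : a ∈ Ω
  · obtain ⟨K, hKΩ, hK, hKa⟩ := hint a haΩ
    refine ⟨K ×ˢ univ, mem_nhdsWithin_of_mem_nhds (prod_mem_nhds hKa univ_mem), K, hKΩ, hK, ?_⟩
    rintro ⟨x, y⟩ hp - - S ⟨L, γ, hL, -, h0, -, -, rfl⟩
    exact ⟨x, ⟨0, ⟨le_rfl, hL⟩, h0⟩, hp.1⟩
  by_cases hbΩ : b ∈ Ω
  · obtain ⟨K, hKΩ, hK, hKb⟩ := hint b hbΩ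
    refine ⟨univ ×ˢ K, mem_nhdsWithin_of_mem_nhds (prod_mem_nhds univ_mem hKb), K, hKΩ, hK, ?_⟩
    rintro ⟨x, y⟩ hp - - S ⟨L, γ, hL, -, -, hL', -, rfl⟩
    exact ⟨y, ⟨L, ⟨hL, le_rfl⟩, hL'⟩, hp.2⟩
  by_cases hac : a ∈ closure Ω
  swap
  · refine ⟨(closure Ω)ᶜ ×ˢ univ, mem_nhdsWithin_of_mem_nhds (prod_mem_nhds
      (isClosed_closure.isOpen_compl.mem_nhds hac) univ_mem), ∅, empty_subset _, isCompact_empty,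
      fun p hp h1 => absurd (subset_closure h1) hp.1⟩
  by_cases hbc : b ∈ closure Ω
  swap
  · refine ⟨univ ×ˢ (closure Ω)ᶜ, mem_nhdsWithin_of_mem_nhds (prod_mem_nhds univ_mem
      (isClosed_closure.isOpen_compl.mem_nhds hbc)), ∅, empty_subset _, isCompact_empty,
      fun p hp _ h2 => absurd (subset_closure h2) hp.2⟩
  obtain ⟨V, hV, V', hV', K, hK, hKΩ, -, H⟩ := h a (by rw [ho.frontier_eq]; exact ⟨hac, haΩ⟩) b
    (by rw [ho.frontier_eq]; exact ⟨hbc, hbΩ⟩) (hAB.ne_of_mem ha hb)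
  exact ⟨V ×ˢ V', mem_nhdsWithin_of_mem_nhds (prod_mem_nhds hV hV'), K, hKΩ, hK,
    fun p hp h1 h2 S hS => H p.1 ⟨hp.1, h1⟩ p.2 ⟨hp.2, h2⟩ S hS⟩

end Kobayashi

end

/-! ### Localization of the Kobayashi distance and of visibility -/

noncomputable section

namespace Kobayashi

open MetricGeometry

variable {d : ℕ}

/-- A disc centred at a point which is far from the complement of `U` may be shrunk into `U`. -/
lemma exists_lempert_le_mul {δ : ℝ} (hδ : 0 < δ) :
    ∃ A η : ℝ, 0 < A ∧ 0 < η ∧ ∀ (X U : Set (Cn d)) (z w : Cn d),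
      (∀ v ∈ X, kob X z v < ENNReal.ofReal δ → v ∈ U) → lempert X z w < ENNReal.ofReal η →
      lempert U z w / ENNReal.ofReal A ≤ lempert X z w := by
  -- The subdisc of radius `ρ` has Poincaré radius `δ`, so `g` maps it into `U`.
  set ρ := Real.tanh δ with hρ
  have hρ0 : 0 < ρ := by
    rw [hρ, Real.tanh_eq_sinh_div_cosh]
    exact div_pos (Real.sinh_pos_iff.2 hδ) (Real.cosh_pos δ)
  have hρ1 : ρ < 1 := Real.tanh_lt_one δ
  refine ⟨4 / ρ, Real.artanh (ρ / 2), by positivity,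
    Real.artanh_pos ⟨by linarith, by linarith⟩, fun X U z w hU hη => ?_⟩
  refine le_of_forall_gt fun r hr => ?_
  obtain ⟨g, t, hg, hX, ht0, ht1, rfl, rfl, htr⟩ := exists_disc_of_lempert_lt (lt_min hr hη)
  rw [lt_min_iff] at htr
  have htρ : t < ρ / 2 := by
    have := (ENNReal.ofReal_lt_ofReal_iff_of_nonneg (Real.artanh_nonneg ht0)).1 htr.2
    rwa [Real.artanh_lt_artanh_iff ⟨by linarith, ht1⟩ ⟨by linarith, by linarith⟩] at this
  have hscale : MapsTo (fun ζ : ℂ => (ρ : ℂ) * ζ) disc disc := fun ζ hζ => by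
    rw [disc, mem_ball_zero_iff] at *
    rw [norm_mul, Complex.norm_real, Real.norm_of_nonneg hρ0.le]
    nlinarith [norm_nonneg ζ]
  have hgU : MapsTo (fun ζ : ℂ => g (ρ * ζ)) disc U := fun ζ hζ => by
    refine hU _ (hX (hscale hζ)) (((kob_le_lempert _ _ _).trans
      (lempert_zero_le hg hX (hscale hζ))).trans_lt ?_)
    rw [← Real.artanh_tanh δ, ENNReal.ofReal_lt_ofReal_iff (by rwa [Real.artanh_tanh])]
    rw [disc, mem_ball_zero_iff] at hζ
    refine Real.artanh_lt_artanh (by linarith [norm_nonneg ((ρ : ℂ) * ζ)]) hρ1 ?_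
    rw [norm_mul, Complex.norm_real, Real.norm_of_nonneg hρ0.le]
    nlinarith [norm_nonneg ζ]
  have htρ' : t / ρ ≤ 1 / 2 := by rw [div_le_iff₀ hρ0]; linarith
  have key := lempert_zero_le (hg.comp (by fun_prop) hscale) hgU
    (ofReal_mem_disc (t := t / ρ) (by positivity) (by linarith))
  have hρc : (ρ : ℂ) ≠ 0 := by exact_mod_cast hρ0.ne'
  have e1 : (ρ : ℂ) * ((t / ρ : ℝ) : ℂ) = t := by push_cast; field_simp
  simp only [Function.comp, mul_zero, e1] at key
  rw [Complex.norm_real, Real.norm_of_nonneg (by positivity)] at key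
  refine lt_of_le_of_lt ?_ htr.1
  refine ENNReal.div_le_of_le_mul (key.trans ?_)
  rw [← ENNReal.ofReal_mul (Real.artanh_nonneg ht0)]
  -- `artanh (t / ρ) ≤ 2 * t / ρ` and `t ≤ 2 * artanh t` give the factor `4 / ρ`.
  refine ENNReal.ofReal_le_ofReal ((artanh_le_two_mul (by positivity) htρ').trans ?_)
  have := half_le_artanh ht0 ht1
  rw [mul_div_assoc', mul_div_assoc']
  rw [div_le_div_iff_of_pos_right hρ0]
  linarith

/-- Localization of the Kobayashi distance: near points which are far from the complement of `U`,
the distance of `U` is bounded by a multiple of that of `X`. -/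
lemma exists_kob_le_mul {δ : ℝ} (hδ : 0 < δ) :
    ∃ A η : ℝ, 0 < A ∧ 0 < η ∧ ∀ (X U : Set (Cn d)) (z w : Cn d),
      (∀ v ∈ X, kob X z v < ENNReal.ofReal δ → v ∈ U) → kob X z w < ENNReal.ofReal η →
      kob U z w ≤ ENNReal.ofReal A * kob X z w := by
  obtain ⟨A, η, hA, hη, H⟩ := exists_lempert_le_mul (d := d) (half_pos hδ)
  refine ⟨A, min η (δ / 2), hA, lt_min hη (half_pos hδ), fun X U z w hU hzw => ?_⟩
  rw [mul_comm]
  rw [← ENNReal.div_le_iff (ENNReal.ofReal_pos.2 hA).ne' ENNReal.ofReal_ne_top]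
  refine le_of_forall_gt fun r hr => ?_
  obtain ⟨n, c, rfl, rfl, hc⟩ := kob_lt_iff.1 (lt_min hr hzw)
  rw [lt_min_iff] at hc
  refine lt_of_le_of_lt ?_ hc.1
  -- A chain shorter than `δ / 2` keeps its vertices within `δ / 2` of `z`, so discs centred there
  -- still have room `δ / 2`.
  have hstep : ∀ i < n, lempert U (c i) (c (i + 1)) / ENNReal.ofReal A ≤
      lempert X (c i) (c (i + 1)) := by
    intro i hi
    refine H X U _ _ (fun v hv hvd => hU v hv ?_) ?_
    · refine (kob_triangle X _ (c i) v).trans_lt ?_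
      rw [← add_halves δ, ENNReal.ofReal_add (by positivity) (by positivity)]
      refine ENNReal.add_lt_add ?_ hvd
      refine lt_of_le_of_lt ?_ (hc.2.trans_le (ENNReal.ofReal_le_ofReal (min_le_right _ _)))
      refine (kob_le_sum (n := i) rfl rfl).trans
        (Finset.sum_le_sum_of_subset (Finset.range_mono hi.le))
    · refine lt_of_le_of_lt ?_ (hc.2.trans_le (ENNReal.ofReal_le_ofReal (min_le_left _ _)))
      exact Finset.single_le_sum (f := fun i => lempert X (c i) (c (i + 1)))
        (fun _ _ => zero_le) (Finset.mem_range.2 hi)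
  calc kob U (c 0) (c n) / ENNReal.ofReal A
      ≤ (∑ i ∈ Finset.range n, lempert U (c i) (c (i + 1))) / ENNReal.ofReal A := by
        gcongr; exact kob_le_sum rfl rfl
    _ = ∑ i ∈ Finset.range n, lempert U (c i) (c (i + 1)) / ENNReal.ofReal A := by
        simp only [div_eq_mul_inv, Finset.sum_mul]
    _ ≤ _ := Finset.sum_le_sum fun i hi => hstep i (Finset.mem_range.1 hi)

/-- `γ` is an isometric embedding of `[a, b]` for `kob X`. -/
def IsKobIsometryOn (X : Set (Cn d)) (γ : ℝ → Cn d) (a b : ℝ) : Prop :=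
  ∀ s ∈ Icc a b, ∀ t ∈ Icc a b, kob X (γ s) (γ t) = ENNReal.ofReal |s - t|

lemma IsKobIsometryOn.mono {X : Set (Cn d)} {γ : ℝ → Cn d} {a b a' b' : ℝ}
    (h : IsKobIsometryOn X γ a b) (ha : a ≤ a') (hb : b' ≤ b) : IsKobIsometryOn X γ a' b' :=
  fun s hs t ht => h s (Icc_subset_Icc ha hb hs) t (Icc_subset_Icc ha hb ht)

lemma IsKobIsometryOn.continuousOn {X : Set (Cn d)} (hX : Bornology.IsBounded X) {γ : ℝ → Cn d}
    {a b : ℝ} (h : IsKobIsometryOn X γ a b) : ContinuousOn γ (Icc a b) := by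
  obtain ⟨c, hc, hcd⟩ := exists_mul_dist_le_kob hX
  lift c to NNReal using hc.le
  refine (LipschitzOnWith.of_dist_le_mul (K := c⁻¹) fun s hs t ht => ?_).continuousOn
  have := hcd (γ s) (γ t)
  rw [h s hs t ht, ENNReal.ofReal_le_ofReal_iff (abs_nonneg _)] at this
  rw [NNReal.coe_inv, le_inv_mul_iff₀ hc, Real.dist_eq]
  exact this

/-- Along a geodesic of `X` staying far from the complement of `U`, the distance of `U` is bounded
by a multiple of that of `X`. -/
lemma exists_kob_le_mul_of_isKobIsometryOn {δ : ℝ} (hδ : 0 < δ) :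
    ∃ A : ℝ, 0 < A ∧ ∀ (X U : Set (Cn d)) (γ : ℝ → Cn d) (a b : ℝ), IsKobIsometryOn X γ a b →
      (∀ s ∈ Icc a b, ∀ v ∈ X, kob X (γ s) v < ENNReal.ofReal δ → v ∈ U) → a ≤ b →
      kob U (γ a) (γ b) ≤ ENNReal.ofReal (A * (b - a)) := by
  obtain ⟨A, η, hA, hη, H⟩ := exists_kob_le_mul (d := d) hδ
  refine ⟨A, hA, fun X U γ a b hγ hU hab => ?_⟩
  have hshort : ∀ s ∈ Icc a b, ∀ t ∈ Icc a b, s ≤ t → t - s ≤ η / 2 →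
      kob U (γ s) (γ t) ≤ ENNReal.ofReal (A * (t - s)) := fun s hs t ht hst hη' => by
    have h1 := hγ s hs t ht
    rw [abs_sub_comm, abs_of_nonneg (by linarith)] at h1
    have := H X U _ _ (hU s hs) (by
      rw [h1, ENNReal.ofReal_lt_ofReal_iff hη]
      linarith)
    rwa [h1, ← ENNReal.ofReal_mul hA.le] at this
  -- Localization holds only at distances below `η`, so the geodesic is cut into steps of length `η
  -- / 2`.
  have hind : ∀ n : ℕ, ∀ t ∈ Icc a b, t - a ≤ n * (η / 2) →
      kob U (γ a) (γ t) ≤ ENNReal.ofReal (A * (t - a)) := by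
    intro n
    induction n with
    | zero =>
      intro t ht h
      obtain rfl : t = a := le_antisymm (by simpa using h) ht.1
      simp
    | succ n ih =>
      intro t ht h
      push_cast at h
      by_cases hta : t - a ≤ η / 2
      · exact hshort a ⟨le_rfl, hab⟩ t ht ht.1 hta
      · have hm : t - η / 2 ∈ Icc a b := ⟨by linarith, by linarith [ht.2]⟩
        have h1 := ih _ hm (by linarith)
        have h2 := hshort _ hm t ht (by linarith) (by linarith)
        refine (kob_triangle U _ _ _).trans ((add_le_add h1 h2).trans ?_)
        rw [← ENNReal.ofReal_add (mul_nonneg hA.le (by linarith [hm.1]))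
          (mul_nonneg hA.le (by linarith))]
        exact ENNReal.ofReal_le_ofReal (by linarith)
  obtain ⟨n, hn⟩ := exists_nat_ge ((b - a) / (η / 2))
  rw [div_le_iff₀ (by positivity)] at hn
  exact hind n b ⟨hab, le_rfl⟩ hn

lemma exists_first_hit {f : ℝ → ℝ} {L a s₁ : ℝ} (hf : ContinuousOn f (Icc 0 L)) (h0 : f 0 ≤ a)
    (hs₁ : s₁ ∈ Icc 0 L) (h1 : a ≤ f s₁) :
    ∃ T ∈ Icc 0 L, f T = a ∧ ∀ s ∈ Icc 0 T, f s ≤ a := by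
  have hL : (0 : ℝ) ≤ L := hs₁.1.trans hs₁.2
  obtain ⟨s₂, hs₂, hfs₂⟩ := intermediate_value_Icc hs₁.1
    (hf.mono (Icc_subset_Icc_right hs₁.2)) ⟨h0, h1⟩
  have hcl : IsCompact (Icc 0 L ∩ f ⁻¹' {a}) :=
    isCompact_Icc.of_isClosed_subset (hf.preimage_isClosed_of_isClosed isClosed_Icc
      isClosed_singleton) inter_subset_left
  obtain ⟨T, ⟨hT, hTa⟩, hmin⟩ := hcl.exists_isLeast
    ⟨s₂, ⟨hs₂.1, hs₂.2.trans hs₁.2⟩, hfs₂⟩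
  refine ⟨T, hT, hTa, fun s hs => ?_⟩
  by_contra! hlt
  obtain ⟨u, hu, hua⟩ := intermediate_value_Icc hs.1
    (hf.mono (Icc_subset_Icc_right (hs.2.trans hT.2))) ⟨h0, hlt.le⟩
  have hTu : T ≤ u := hmin ⟨⟨hu.1, hu.2.trans (hs.2.trans hT.2)⟩, hua⟩
  have hsT : s = T := le_antisymm hs.2 (hTu.trans hu.2)
  rw [hsT, show f T = a from hTa] at hlt
  exact lt_irrefl _ hlt

/-- The Kobayashi pseudodistance is bounded on compact subsets of a connected open set. -/
lemma exists_kob_le_of_isCompact {U K : Set (Cn d)} (hU : IsOpen U) (hc : IsPreconnected U)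
    (hK : IsCompact K) (hKU : K ⊆ U) :
    ∃ C : ℝ, 0 ≤ C ∧ ∀ z ∈ K, ∀ w ∈ K, kob U z w ≤ ENNReal.ofReal C := by
  rcases K.eq_empty_or_nonempty with rfl | ⟨o, ho⟩
  · exact ⟨0, le_rfl, by simp⟩
  obtain ⟨m, hm, hmax⟩ := hK.exists_isMaxOn ⟨o, ho⟩ ((continuousOn_kob hU o).mono hKU)
  have hfin := kob_ne_top hU hc (hKU ho) (hKU hm)
  refine ⟨(kob U o m).toReal + (kob U o m).toReal, by positivity, fun z hz w hw => ?_⟩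
  rw [ENNReal.ofReal_add ENNReal.toReal_nonneg ENNReal.toReal_nonneg, ENNReal.ofReal_toReal hfin]
  refine (kob_triangle U z o w).trans (add_le_add ?_ (hmax hw))
  rw [kob_comm]
  exact hmax hz

variable {D : BoundedDomain d} {W : Set (Cn d)} {q : Cn d} {r : ℝ}

/-- Additive and multiplicative localization of the Kobayashi distance of a visible domain near a
point. -/
lemma exists_kob_inter_le (hg : IsGeodesicSpace D.Pt) (hvis : IsVisible D.carrier)
    (hWo : IsOpen W) (hconn : IsPreconnected (D.carrier ∩ W)) (hr : 0 < r)
    (hW : Metric.closedBall q (4 * r) ⊆ W) :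
    ∃ A C : ℝ, 0 ≤ A ∧ 0 ≤ C ∧ ∀ z w : D.Pt, z.val ∈ Metric.closedBall q (2 * r) →
      w.val ∈ Metric.closedBall q (2 * r) →
      kob (D.carrier ∩ W) z.val w.val ≤ ENNReal.ofReal (A * dist z w + C) := by
  obtain ⟨c, hc, hcd⟩ := exists_mul_dist_le_kob D.isBounded
  obtain ⟨A, hA, HA⟩ := exists_kob_le_mul_of_isKobIsometryOn (d := d) (mul_pos hc hr)
  -- A Kobayashi ball of radius `c * r` lies in the Euclidean ball of radius `r`, hence stays within
  -- `4 * r` of `q`.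
  have hfar : ∀ z ∈ Metric.closedBall q (3 * r), ∀ v ∈ D.carrier,
      kob D.carrier z v < ENNReal.ofReal (c * r) → v ∈ D.carrier ∩ W := by
    intro z hz v hv hzv
    refine ⟨hv, hW ?_⟩
    have := (hcd z v).trans_lt hzv
    rw [ENNReal.ofReal_lt_ofReal_iff (by positivity), mul_lt_mul_iff_right₀ hc] at this
    rw [Metric.mem_closedBall] at *
    linarith [dist_triangle_left v q z]
  obtain ⟨K, hKD, hK, HK⟩ := hvis.exists_isCompact D.isOpen
    (isCompact_closedBall q (2 * r)) (isCompact_sphere q (3 * r))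
    (Set.disjoint_left.2 fun x h1 h2 => by
      rw [Metric.mem_closedBall] at h1
      rw [Metric.mem_sphere] at h2
      linarith)
  obtain ⟨C, hC0, hC⟩ := exists_kob_le_of_isCompact (D.isOpen.inter hWo) hconn
    (hK.inter_right (Metric.isClosed_closedBall (x := q) (ε := 3 * r)))
    (fun x hx => ⟨hKD hx.1, hW (Metric.closedBall_subset_closedBall (by linarith) hx.2)⟩)
  -- a geodesic leaving the ball of radius `3 * r` meets `K` before
  have hleave : ∀ (γ : ℝ → Cn d) (L : ℝ), IsKobIsometryOn D.carrier γ 0 L →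
      MapsTo γ (Icc 0 L) D.carrier → γ 0 ∈ Metric.closedBall q (2 * r) →
      (∃ s ∈ Icc 0 L, 3 * r ≤ dist (γ s) q) →
      ∃ s ∈ Icc 0 L, γ s ∈ K ∩ Metric.closedBall q (3 * r) ∧
        kob (D.carrier ∩ W) (γ 0) (γ s) ≤ ENNReal.ofReal (A * L) := by
    rintro γ L hγ hmaps h0 ⟨s₁, hs₁, hd₁⟩
    rw [Metric.mem_closedBall] at h0
    obtain ⟨T, hT, hTd, hTle⟩ := exists_first_hit (f := fun s => dist (γ s) q)
      ((continuous_id.dist continuous_const).comp_continuousOn (hγ.continuousOn D.isBounded)) (by linarith) hs₁ hd₁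
    obtain ⟨_, ⟨s, hs, rfl⟩, hsK⟩ := HK (γ 0) ⟨h0, hmaps ⟨le_rfl, hT.1.trans hT.2⟩⟩ (γ T)
      ⟨hTd, hmaps hT⟩ _ ⟨T, γ, hT.1, fun s hs => hmaps ⟨hs.1, hs.2.trans hT.2⟩, rfl, rfl,
        hγ.mono le_rfl hT.2, rfl⟩
    refine ⟨s, ⟨hs.1, hs.2.trans hT.2⟩, ⟨hsK, hTle s hs⟩, ?_⟩
    refine (HA _ _ γ 0 s (hγ.mono le_rfl (hs.2.trans hT.2))
      (fun u hu => hfar _ (hTle u ⟨hu.1, hu.2.trans hs.2⟩)) hs.1).trans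
      (ENNReal.ofReal_le_ofReal ?_)
    rw [sub_zero]
    gcongr
    exact hs.2.trans hT.2
  -- Each of the two end pieces costs at most `A * L`; the jump between points of the compact set
  -- costs `C`.
  refine ⟨2 * A, C, by positivity, hC0, fun z w hz hw => ?_⟩
  obtain ⟨S, hS⟩ := hg z w
  obtain ⟨L, γ, hL, hmaps, hγ0, hγL, hγ, -⟩ := BoundedDomain.isGeodesicSegment_image hS
  change IsKobIsometryOn D.carrier γ 0 L at hγ
  have hdist : dist z w = L := by
    rw [BoundedDomain.dist_eq_iff hL, ← hγ0, ← hγL, hγ 0 ⟨le_rfl, hL⟩ L ⟨hL, le_rfl⟩, zero_sub,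
      abs_neg, abs_of_nonneg hL]
  rw [hdist, ← hγ0, ← hγL]
  rw [← hγ0] at hz
  rw [← hγL] at hw
  by_cases hex : ∃ s ∈ Icc 0 L, 3 * r ≤ dist (γ s) q
  · obtain ⟨s, hs, hsK, hs1⟩ := hleave γ L hγ hmaps hz hex
    have hrev : ∀ u ∈ Icc 0 L, L - u ∈ Icc 0 L := fun u hu =>
      ⟨by linarith [hu.2], by linarith [hu.1]⟩
    -- The reversed geodesic handles the other end. The two pieces may overlap, which is harmless.
    obtain ⟨t, ht, htK, ht1⟩ := hleave (fun u => γ (L - u)) L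
      (fun u hu v hv => by
        rw [hγ _ (hrev u hu) _ (hrev v hv), abs_sub_comm]
        congr 2; ring)
      (fun u hu => hmaps (hrev u hu)) (by simpa using hw)
      (by
        obtain ⟨u, hu, hud⟩ := hex
        exact ⟨L - u, hrev u hu, by simpa using hud⟩)
    simp only [sub_zero] at ht1
    rw [kob_comm] at ht1
    have h3 := (kob_triangle (D.carrier ∩ W) (γ 0) (γ s) (γ (L - t))).trans
      (add_le_add hs1 (hC _ hsK _ htK))
    refine (kob_triangle (D.carrier ∩ W) (γ 0) (γ (L - t)) (γ L)).trans
      ((add_le_add h3 ht1).trans ?_)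
    rw [← ENNReal.ofReal_add (by positivity) hC0,
      ← ENNReal.ofReal_add (by positivity) (by positivity)]
    exact ENNReal.ofReal_le_ofReal (by linarith)
  · push Not at hex
    refine (HA _ _ γ 0 L hγ (fun u hu => hfar _ (hex u hu).le) hL).trans
      (ENNReal.ofReal_le_ofReal ?_)
    have : 0 ≤ A * L := by positivity
    linarith

theorem isVisibleNhd_of_isGromovHyperbolic (hcomp : IsCompleteHyperbolic D.carrier)
    (hgrom : IsGromovHyperbolic D.carrier) (hvis : IsVisible D.carrier) (hWo : IsOpen W)
    (hconn : IsPreconnected (D.carrier ∩ W)) : IsVisibleNhd D.carrier W := by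
  rintro q₁ ⟨-, hq₁⟩ q₂ ⟨-, hq₂⟩ hne
  have := BoundedDomain.completeSpace hcomp
  have := D.isLengthMetric.properSpace
  have hg := D.isLengthMetric.isGeodesicSpace
  obtain ⟨δ, hδ, hthin⟩ := BoundedDomain.hasThinTriangles hgrom
  obtain ⟨r, hr, hrW, hrd⟩ : ∃ r > 0, Metric.closedBall q₁ (4 * r) ⊆ W ∧
      3 * r ≤ dist q₁ q₂ := by
    obtain ⟨ε, hε, hεW⟩ := Metric.nhds_basis_closedBall.mem_iff.1 (hWo.mem_nhds hq₁)
    have hd := dist_pos.2 hne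
    refine ⟨min (ε / 4) (dist q₁ q₂ / 3), by positivity,
      (Metric.closedBall_subset_closedBall ?_).trans hεW, ?_⟩
    · linarith [min_le_left (ε / 4) (dist q₁ q₂ / 3)]
    · linarith [min_le_right (ε / 4) (dist q₁ q₂ / 3)]
  obtain ⟨A, C, hA, hC, HAC⟩ := exists_kob_inter_le hg hvis hWo hconn hr hrW
  obtain ⟨M, HM⟩ := hthin.geodesic_near_quasigeodesic hδ hg (C := C) hA
  obtain ⟨K₀, hK₀D, hK₀, HK₀⟩ := hvis.exists_isCompact D.isOpen
    (isCompact_closedBall q₁ r) (isCompact_sphere q₁ (2 * r))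
    (Set.disjoint_left.2 fun x h1 h2 => by
      rw [Metric.mem_closedBall] at h1
      rw [Metric.mem_sphere] at h2
      linarith)
  have hK₀' : IsCompact (BoundedDomain.Pt.val ⁻¹' K₀ : Set D.Pt) :=
    (BoundedDomain.isOpenEmbedding_val (D := D)).isInducing.isCompact_preimage' hK₀
      fun x hx => ⟨⟨x, hK₀D hx⟩, rfl⟩
  refine ⟨Metric.ball q₁ r, Metric.ball_mem_nhds _ hr, Metric.ball q₂ r, Metric.ball_mem_nhds _ hr,
    BoundedDomain.Pt.val '' (Metric.cthickening M (BoundedDomain.Pt.val ⁻¹' K₀ : Set D.Pt)) ∩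
      Metric.closedBall q₁ (2 * r), ?_, ?_, Metric.ball_disjoint_ball (by linarith), ?_⟩
  · exact (hK₀'.cthickening.image BoundedDomain.isOpenEmbedding_val.continuous).inter_right
      Metric.isClosed_closedBall
  · rintro _ ⟨⟨x, -, rfl⟩, hx⟩
    exact ⟨x.2, hrW (Metric.closedBall_subset_closedBall (by linarith) hx)⟩
  rintro x ⟨hx, hxU⟩ y ⟨hy, hyU⟩ S ⟨L, γ, hL, hmaps, rfl, rfl, hγ, rfl⟩
  change IsKobIsometryOn (D.carrier ∩ W) γ 0 L at hγ
  rw [Metric.mem_ball] at hx hy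
  -- The comparison of the two distances is available only inside the ball of radius `2 * r`. The
  -- geodesic reaches its boundary because its end point is within `r` of `q₂` and `3 * r ≤ dist q₁
  -- q₂`.
  obtain ⟨T, hT, hTd, hTle⟩ := exists_first_hit (f := fun s => dist (γ s) q₁) (a := 2 * r)
    ((continuous_id.dist continuous_const).comp_continuousOn
      (hγ.continuousOn (D.isBounded.subset inter_subset_left)))
    (by linarith) ⟨hL, le_rfl⟩ (by
      have := dist_triangle_left q₁ q₂ (γ L)
      linarith)
  have hsub : ∀ s ∈ Icc 0 T, s ∈ Icc 0 L := fun s hs => ⟨hs.1, hs.2.trans hT.2⟩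
  have h0T : (0 : ℝ) ∈ Icc 0 T := ⟨le_rfl, hT.1⟩
  have hTT : T ∈ Icc 0 T := ⟨hT.1, le_rfl⟩
  obtain ⟨c, hc⟩ : ∃ c : ℝ → D.Pt, ∀ s ∈ Icc 0 T, (c s).val = γ s := by
    have : ∀ s, ∃ p : D.Pt, s ∈ Icc 0 T → p.val = γ s := fun s => by
      by_cases hs : s ∈ Icc 0 T
      · exact ⟨⟨γ s, (hmaps (hsub s hs)).1⟩, fun _ => rfl⟩
      · exact ⟨⟨γ 0, hxU.1⟩, fun h => absurd h hs⟩
    choose c hc using this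
    exact ⟨c, hc⟩
  have hc1 : ∀ s ∈ Icc 0 T, ∀ t ∈ Icc 0 T, dist (c s) (c t) ≤ |s - t| := fun s hs t ht => by
    rw [BoundedDomain.dist_le_iff (abs_nonneg _), hc s hs, hc t ht,
      ← hγ s (hsub s hs) t (hsub t ht)]
    exact kob_mono inter_subset_left _ _
  have hc2 : ∀ s ∈ Icc 0 T, ∀ t ∈ Icc 0 T, |s - t| ≤ A * dist (c s) (c t) + C :=
    fun s hs t ht => by
      have := HAC (c s) (c t) (by rw [hc s hs]; exact hTle s hs) (by rw [hc t ht]; exact hTle t ht)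
      rwa [hc s hs, hc t ht, hγ s (hsub s hs) t (hsub t ht),
        ENNReal.ofReal_le_ofReal_iff (by positivity)] at this
  obtain ⟨S, hS⟩ := hg (c 0) (c T)
  -- Visibility of the whole domain gives a point of `K₀` on its geodesic; the Morse lemma moves it
  -- to the local geodesic.
  obtain ⟨_, ⟨o, hoS, rfl⟩, hoK⟩ := HK₀ (c 0).val ⟨by rw [hc 0 h0T]; exact hx.le, (c 0).2⟩ (c T).val
    ⟨by rw [hc T hTT]; exact hTd, (c T).2⟩ _ (BoundedDomain.isGeodesicSegment_image hS)
  obtain ⟨s, hs, hos⟩ := HM T c hT.1 hc1 hc2 S hS o hoS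
  refine ⟨γ s, ⟨s, hsub s hs, rfl⟩, ⟨c s, ?_, hc s hs⟩, hTle s hs⟩
  exact Metric.mem_cthickening_of_dist_le _ o _ _ hoK (by rwa [dist_comm])

end Kobayashi

end

/-! ### Complete hyperbolicity of intersections and components -/

noncomputable section

namespace Kobayashi

variable {d : ℕ}

/-- If the Kobayashi pseudodistance of `X` is a distance, then convergence for it implies
convergence in the Euclidean topology (Barth). -/
lemma tendsto_of_tendsto_kob {X : Set (Cn d)} (hX : IsOpen X)
    (hsep : ∀ z ∈ X, ∀ w ∈ X, kob X z w = 0 → z = w) {z : Cn d} (hz : z ∈ X) {u : ℕ → Cn d}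
    (hu : Tendsto (fun n => kob X (u n) z) atTop (𝓝 0)) : Tendsto u atTop (𝓝 z) := by
  obtain ⟨ε₀, hε₀, hε₀X⟩ := Metric.nhds_basis_closedBall.mem_iff.1 (hX.mem_nhds hz)
  refine Metric.tendsto_nhds.2 fun ε hε => ?_
  set r := min ε₀ (ε / 2) with hr
  have hr0 : 0 < r := lt_min hε₀ (half_pos hε)
  have hrX : Metric.closedBall z r ⊆ X :=
    (Metric.closedBall_subset_closedBall (min_le_left _ _)).trans hε₀X
  obtain ⟨η, hη, hmin⟩ : ∃ η : ℝ≥0∞, 0 < η ∧ ∀ w ∈ Metric.sphere z r, η ≤ kob X z w := by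
    rcases (Metric.sphere z r).eq_empty_or_nonempty with h | h
    · exact ⟨1, one_pos, by simp [h]⟩
    obtain ⟨m, hm, hmin⟩ := (isCompact_sphere z r).exists_isMinOn h
      ((continuousOn_kob hX z).mono (Metric.sphere_subset_closedBall.trans hrX))
    refine ⟨kob X z m, pos_iff_ne_zero.2 fun h0 => ?_, fun w hw => hmin hw⟩
    have := hsep z hz m (hrX (Metric.sphere_subset_closedBall hm)) h0
    rw [← this, Metric.mem_sphere, dist_self] at hm
    exact hr0.ne hm
  filter_upwards [hu.eventually (gt_mem_nhds hη)] with n hn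
  rw [kob_comm] at hn
  -- The connected set would cross the sphere of radius `r`, where the distance to `z` is at least
  -- `η`.
  obtain ⟨C, -, hC, hzC, hnC, hCd⟩ := exists_isPreconnected_of_kob_lt hz hn
  by_contra! hfar
  obtain ⟨m, hm, hmd⟩ := hC.intermediate_value hzC hnC
    (continuous_id.dist (continuous_const (y := z))).continuousOn
    (show r ∈ Icc _ _ from ⟨by simpa using hr0.le, by
      have := min_le_right ε₀ (ε / 2)
      simp only [id]
      linarith⟩)
  exact (hmin m hmd).not_gt (le_self_add.trans_lt (hCd m hm))

lemma tendsto_kob_of_tendsto {X : Set (Cn d)} (hX : IsOpen X) {z : Cn d} (hz : z ∈ X)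
    {u : ℕ → Cn d} (hu : Tendsto u atTop (𝓝 z)) :
    Tendsto (fun n => kob X (u n) z) atTop (𝓝 0) :=
  ((tendsto_kob_nhds hX hz).comp hu).congr fun n => kob_comm X z (u n)

/-- Inclusions decrease the distance, so the sequence is Cauchy for the larger set; Barth's theorem
makes the limit Euclidean and thus comparable between different sets. -/
lemma IsCompleteHyperbolic.exists_tendsto {X Y : Set (Cn d)} (hY : IsOpen Y)
    (h : IsCompleteHyperbolic Y) (hXY : X ⊆ Y) {u : ℕ → Cn d} (hu : ∀ n, u n ∈ X)
    (hc : ∀ ε : ℝ≥0∞, 0 < ε → ∃ N, ∀ m ≥ N, ∀ n ≥ N, kob X (u m) (u n) < ε) :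
    ∃ z ∈ Y, Tendsto u atTop (𝓝 z) := by
  obtain ⟨z, hz, hlim⟩ := h.2 u (fun n => hXY (hu n)) fun ε hε => by
    obtain ⟨N, hN⟩ := hc ε hε
    exact ⟨N, fun m hm n hn => (kob_mono hXY _ _).trans_lt (hN m hm n hn)⟩
  exact ⟨z, hz, tendsto_of_tendsto_kob hY h.1 hz hlim⟩

lemma IsCompleteHyperbolic.inter {X Y : Set (Cn d)} (hX : IsOpen X) (hY : IsOpen Y)
    (hXc : IsCompleteHyperbolic X) (hYc : IsCompleteHyperbolic Y) :
    IsCompleteHyperbolic (X ∩ Y) := by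
  refine ⟨fun z hz w hw h => hXc.1 z hz.1 w hw.1 ?_, fun u hu hc => ?_⟩
  · exact le_antisymm (h ▸ kob_mono inter_subset_left z w) zero_le
  · obtain ⟨z, hz, hlim⟩ := hXc.exists_tendsto hX inter_subset_left hu hc
    obtain ⟨z', hz', hlim'⟩ := hYc.exists_tendsto hY inter_subset_right hu hc
    obtain rfl := tendsto_nhds_unique hlim hlim'
    exact ⟨z, ⟨hz, hz'⟩, tendsto_kob_of_tendsto (hX.inter hY) ⟨hz, hz'⟩ hlim⟩

lemma IsCompleteHyperbolic.connectedComponentIn {X : Set (Cn d)} (hX : IsOpen X)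
    (hXc : IsCompleteHyperbolic X) (x : Cn d) :
    IsCompleteHyperbolic (connectedComponentIn X x) := by
  have hsub := connectedComponentIn_subset X x
  refine ⟨fun z hz w hw h => hXc.1 z (hsub hz) w (hsub hw) ?_, fun u hu hc => ?_⟩
  · exact le_antisymm (h ▸ kob_mono hsub z w) zero_le
  · obtain ⟨z, hz, hlim⟩ := hXc.exists_tendsto hX hsub hu hc
    have hcl : z ∈ closure (_root_.connectedComponentIn X x) :=
      mem_closure_of_tendsto hlim (Eventually.of_forall hu)
    -- The limit lies in `X` and adding it keeps the component connected: components are relatively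
    -- closed.
    have hpre : IsPreconnected (insert z (_root_.connectedComponentIn X x)) :=
      isPreconnected_connectedComponentIn.subset_closure (subset_insert _ _)
        (insert_subset hcl subset_closure)
    have hzC : z ∈ _root_.connectedComponentIn X x := by
      have hx : x ∈ X := connectedComponentIn_nonempty_iff.1 ⟨u 0, hu 0⟩
      exact hpre.subset_connectedComponentIn
        (mem_insert_of_mem _ (mem_connectedComponentIn hx)) (insert_subset hz hsub)
        (mem_insert _ _)
    exact ⟨z, hzC, tendsto_kob_of_tendsto hX.connectedComponentIn hzC hlim⟩

/-! ### Complete hyperbolicity of balls -/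

/-- A Harnack inequality for holomorphic functions with positive real part. -/
lemma abs_log_norm_sub_le {H : ℂ → ℂ} (hd : DifferentiableOn ℂ H disc)
    (hpos : ∀ ζ ∈ disc, 0 < (H ζ).re) {t : ℝ} (h0 : 0 ≤ t) (h1 : t < 1) :
    |Real.log ‖H 0‖ - Real.log ‖H t‖| ≤ 2 * Real.artanh t := by
  have hP0 := hpos 0 zero_mem_disc
  have hne : ∀ ζ ∈ disc, H ζ + conj (H 0) ≠ 0 := fun ζ hζ h => by
    have := congrArg Complex.re h
    simp only [Complex.add_re, Complex.conj_re, Complex.zero_re] at this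
    linarith [hpos ζ hζ]
  -- A Cayley transform takes the half plane to the disc and `H 0` to `0`; the Schwarz lemma then
  -- gives `‖h t‖ ≤ t`.
  set h : ℂ → ℂ := fun ζ => (H ζ - H 0) / (H ζ + conj (H 0)) with hh
  have hdh : DifferentiableOn ℂ h disc := (hd.sub_const _).div (hd.add_const _) hne
  have hmaps : MapsTo h (Metric.ball 0 1) (Metric.closedBall 0 1) := fun ζ hζ => by
    rw [mem_closedBall_zero_iff, hh, norm_div, div_le_one (norm_pos_iff.2 (hne ζ hζ))]
    refine (sq_le_sq₀ (norm_nonneg _) (norm_nonneg _)).1 ?_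
    rw [← Complex.normSq_eq_norm_sq, ← Complex.normSq_eq_norm_sq]
    simp only [Complex.normSq_apply, Complex.sub_re, Complex.sub_im, Complex.add_re,
      Complex.add_im, Complex.conj_re, Complex.conj_im]
    nlinarith [mul_pos hP0 (hpos ζ hζ)]
  have htd := ofReal_mem_disc h0 h1
  have hS := Complex.norm_le_norm_of_mapsTo_ball (z := (t : ℂ)) hdh hmaps (by simp [hh])
    (by simpa [disc] using htd)
  rw [Complex.norm_real, Real.norm_of_nonneg h0, hh, norm_div,
    div_le_iff₀ (norm_pos_iff.2 (hne _ htd))] at hS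
  have hadd : ‖H t + conj (H 0)‖ ≤ ‖H t‖ + ‖H 0‖ := by
    simpa using norm_add_le (H t) (conj (H 0))
  have hS' := hS.trans (mul_le_mul_of_nonneg_left hadd h0)
  have hn0 : 0 < ‖H 0‖ := hP0.trans_le (Complex.re_le_norm _)
  have hnt : 0 < ‖H t‖ := (hpos _ htd).trans_le (Complex.re_le_norm _)
  have e1 := norm_sub_norm_le (H t) (H 0)
  have e2 := norm_sub_norm_le (H 0) (H t)
  rw [norm_sub_rev] at e2
  have h1t : 0 < 1 - t := by linarith
  have hq : 0 < (1 + t) / (1 - t) := div_pos (by linarith) h1t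
  have f1 : ‖H t‖ ≤ (1 + t) / (1 - t) * ‖H 0‖ := by
    rw [div_mul_eq_mul_div, le_div_iff₀ h1t]; linarith
  have f2 : ‖H 0‖ ≤ (1 + t) / (1 - t) * ‖H t‖ := by
    rw [div_mul_eq_mul_div, le_div_iff₀ h1t]; linarith
  have g1 := Real.log_le_log hnt f1
  have g2 := Real.log_le_log hn0 f2
  rw [Real.log_mul hq.ne' hn0.ne'] at g1
  rw [Real.log_mul hq.ne' hnt.ne'] at g2
  rw [Real.artanh_eq_half_log ⟨by linarith, h1.le⟩, abs_le]
  constructor <;> linarith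

lemma ofReal_abs_log_sub_le_kob {X : Set (Cn d)} {F : Cn d → ℂ} (hF : Differentiable ℂ F)
    (hpos : ∀ z ∈ X, 0 < (F z).re) (z w : Cn d) :
    ENNReal.ofReal (|Real.log ‖F z‖ - Real.log ‖F w‖| / 2) ≤ kob X z w := by
  refine le_kob (e := fun z w => ENNReal.ofReal (|Real.log ‖F z‖ - Real.log ‖F w‖| / 2))
    (by simp) (fun z m w => ?_) (le_lempert fun g t hg hX h0 h1 => ?_) z w
  · rw [← ENNReal.ofReal_add (by positivity) (by positivity)]
    refine ENNReal.ofReal_le_ofReal ?_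
    have := abs_sub_le (Real.log ‖F z‖) (Real.log ‖F m‖) (Real.log ‖F w‖)
    linarith
  · refine ENNReal.ofReal_le_ofReal ?_
    have := abs_log_norm_sub_le (H := F ∘ g) (hF.comp_differentiableOn hg)
      (fun ζ hζ => hpos _ (hX hζ)) h0 h1
    simp only [Function.comp] at this
    linarith

/-- A Cauchy sequence converges in the closed ball. At a boundary limit `z` the supporting complex
hyperplane gives an affine function of positive real part on the ball that vanishes at `z`; the
logarithm of its modulus is Lipschitz for the Kobayashi distance, so it stays bounded along the
sequence, a contradiction. -/
lemma isCompleteHyperbolic_ball (p : Cn d) (r : ℝ) :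
    IsCompleteHyperbolic (Metric.ball p r) := by
  obtain ⟨c, hc, hcd⟩ := exists_mul_dist_le_kob (Metric.isBounded_ball (x := p) (r := r))
  refine ⟨fun z _ w _ h => ?_, fun u hu hcau => ?_⟩
  · have := hcd z w
    rw [h, nonpos_iff_eq_zero, ENNReal.ofReal_eq_zero] at this
    exact dist_le_zero.1 (nonpos_of_mul_nonpos_right this hc)
  have hcs : CauchySeq u := Metric.cauchySeq_iff.2 fun ε hε => by
    obtain ⟨N, hN⟩ := hcau (ENNReal.ofReal (c * ε)) (ENNReal.ofReal_pos.2 (by positivity))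
    refine ⟨N, fun m hm n hn => ?_⟩
    have := (hcd (u m) (u n)).trans_lt (hN m hm n hn)
    rwa [ENNReal.ofReal_lt_ofReal_iff (by positivity), mul_lt_mul_iff_right₀ hc] at this
  obtain ⟨z, hz⟩ := cauchySeq_tendsto_of_complete hcs
  have hzr : z ∈ Metric.closedBall p r := Metric.isClosed_closedBall.mem_of_tendsto hz
    (Eventually.of_forall fun n => Metric.ball_subset_closedBall (hu n))
  by_cases hzb : z ∈ Metric.ball p r
  · exact ⟨z, hzb, tendsto_kob_of_tendsto Metric.isOpen_ball hzb hz⟩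
  exfalso
  have hzp : ‖z - p‖ = r := by
    rw [← dist_eq_norm]
    exact le_antisymm hzr (not_lt.1 hzb)
  set F : Cn d → ℂ := fun w => (r : ℂ) ^ 2 - inner ℂ (z - p) (w - p) with hF
  have hFd : Differentiable ℂ F := by
    have h1 : F = fun w => (r : ℂ) ^ 2 - innerSL ℂ (z - p) (w - p) := rfl
    rw [h1]
    fun_prop
  have hFpos : ∀ w ∈ Metric.ball p r, 0 < (F w).re := fun w hw => by
    rw [Metric.mem_ball, dist_eq_norm] at hw
    have h1 := (Complex.re_le_norm (inner ℂ (z - p) (w - p))).trans (norm_inner_le_norm _ _)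
    rw [hzp] at h1
    simp only [hF, Complex.sub_re, ← Complex.ofReal_pow, Complex.ofReal_re]
    nlinarith [norm_nonneg (w - p)]
  have hFz : F z = 0 := by
    simp only [hF, inner_self_eq_norm_sq_to_K, hzp]
    simp
  obtain ⟨N, hN⟩ := hcau 1 one_pos
  have hlow : ∀ n ≥ N, Real.exp (Real.log ‖F (u N)‖ - 2) ≤ ‖F (u n)‖ := fun n hn => by
    have h1 := (ofReal_abs_log_sub_le_kob hFd hFpos (u N) (u n)).trans_lt (hN N le_rfl n hn)
    rw [← ENNReal.ofReal_one, ENNReal.ofReal_lt_ofReal_iff one_pos] at h1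
    have h2 : 0 < ‖F (u n)‖ := (hFpos _ (hu n)).trans_le (Complex.re_le_norm _)
    rw [← Real.le_log_iff_exp_le h2]
    linarith [le_abs_self (Real.log ‖F (u N)‖ - Real.log ‖F (u n)‖)]
  have hlim : Tendsto (fun n => ‖F (u n)‖) atTop (𝓝 ‖F z‖) :=
    ((hFd.continuous.tendsto z).comp hz).norm
  have := ge_of_tendsto hlim (eventually_atTop.2 ⟨N, hlow⟩)
  rw [hFz, norm_zero] at this
  exact (Real.exp_pos _).not_ge this

/-- A neighbourhood of `p` with connected trace on `Ω` can be enlarged inside any ball containing it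
to a neighbourhood whose trace is a complete hyperbolic domain. -/
lemma exists_isOpen_isCompleteHyperbolic_inter {Ω V : Set (Cn d)} (hΩ : IsOpen Ω)
    (hΩc : IsCompleteHyperbolic Ω) {p : Cn d} {r : ℝ} (hV : IsOpen V)
    (hVr : V ⊆ Metric.ball p r) (hconn : IsConnected (Ω ∩ V)) :
    ∃ W, IsOpen W ∧ V ⊆ W ∧ W ⊆ Metric.ball p r ∧ IsConnected (Ω ∩ W) ∧
      IsCompleteHyperbolic (Ω ∩ W) := by
  obtain ⟨x, hx⟩ := hconn.nonempty
  have hxB : x ∈ Ω ∩ Metric.ball p r := ⟨hx.1, hVr hx.2⟩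
  have ho : IsOpen (Ω ∩ Metric.ball p r) := hΩ.inter Metric.isOpen_ball
  have hC := connectedComponentIn_subset (Ω ∩ Metric.ball p r) x
  have hsub : Ω ∩ V ⊆ connectedComponentIn (Ω ∩ Metric.ball p r) x :=
    hconn.isPreconnected.subset_connectedComponentIn hx (inter_subset_inter_right _ hVr)
  -- `V` is added to make the set a neighbourhood of points outside `Ω`; the trace on `Ω` remains
  -- the component.
  have heq : Ω ∩ (connectedComponentIn (Ω ∩ Metric.ball p r) x ∪ V) =
      connectedComponentIn (Ω ∩ Metric.ball p r) x := by
    rw [inter_union_distrib_left, inter_eq_right.2 fun y hy => (hC hy).1, union_eq_left.2 hsub]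
  refine ⟨_, ho.connectedComponentIn.union hV, subset_union_right,
    union_subset (fun y hy => (hC hy).2) hVr, ?_, ?_⟩
  · rw [heq]
    exact isConnected_connectedComponentIn_iff.2 hxB
  · rw [heq]
    exact (hΩc.inter hΩ Metric.isOpen_ball (isCompleteHyperbolic_ball p r)).connectedComponentIn
      ho x

end Kobayashi

end
-- The proposition
open Kobayashi in
theorem proposition2p8 {d : ℕ} (Ω : Set (Cn d)) (hopen : IsOpen Ω) (hconn : IsConnected Ω)
    (hbdd : Bornology.IsBounded Ω) (hcomplete : IsCompleteHyperbolic Ω)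
    (hgromov : IsGromovHyperbolic Ω) (hvisible : IsVisible Ω) :
    (∀ p ∈ frontier Ω, ∀ W : Set (Cn d), IsOpen W → p ∈ W → IsConnected (Ω ∩ W) →
      IsCompleteHyperbolic (Ω ∩ W) → IsVisibleNhd Ω W) ∧
    (∀ p ∈ frontier Ω, ∀ W : Set (Cn d), IsOpen W → p ∈ W → IsConnected (Ω ∩ W) →
      IsCompleteHyperbolic W → IsCompleteHyperbolic (Ω ∩ W) ∧ IsVisibleNhd Ω W) ∧
    (∀ p ∈ frontier Ω,
      (∃ W : ℕ → Set (Cn d), (𝓝 p).HasBasis (fun _ => True) W ∧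
        ∀ j, IsOpen (W j) ∧ IsConnected (Ω ∩ W j)) →
      ∃ W : ℕ → Set (Cn d), (𝓝 p).HasBasis (fun _ => True) W ∧
        ∀ j, IsOpen (W j) ∧ IsConnected (Ω ∩ W j) ∧ IsCompleteHyperbolic (Ω ∩ W j) ∧
          IsVisibleNhd Ω (W j)) := by
  have hvis : ∀ W : Set (Cn d), IsOpen W → IsConnected (Ω ∩ W) → IsVisibleNhd Ω W :=
    fun W hW hc => isVisibleNhd_of_isGromovHyperbolic (D := ⟨Ω, hopen, hconn, hbdd⟩) hcomplete
      hgromov hvisible hW hc.isPreconnected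
  refine ⟨fun p _ W hW _ hc _ => hvis W hW hc, fun p _ W hW _ hc hWc =>
    ⟨hcomplete.inter hopen hW hWc, hvis W hW hc⟩, ?_⟩
  rintro p - ⟨V, hV, hVp⟩
  have key : ∀ j : ℕ, ∃ W, IsOpen W ∧ W ∈ 𝓝 p ∧ W ⊆ Metric.ball p (1 / (j + 1)) ∧
      IsConnected (Ω ∩ W) ∧ IsCompleteHyperbolic (Ω ∩ W) := fun j => by
    obtain ⟨k, -, hk⟩ := hV.mem_iff.1 (Metric.ball_mem_nhds p (Nat.one_div_pos_of_nat (n := j)))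
    obtain ⟨W, hW, hVW, hWb, hWc, hWh⟩ :=
      exists_isOpen_isCompleteHyperbolic_inter hopen hcomplete (hVp k).1 hk (hVp k).2
    exact ⟨W, hW, mem_of_superset (hV.mem_of_mem trivial) hVW, hWb, hWc, hWh⟩
  choose W hW hWp hWb hWc hWh using key
  refine ⟨W, Filter.hasBasis_iff.2 fun s => ⟨fun hs => ?_, fun ⟨j, _, hj⟩ =>
    mem_of_superset (hWp j) hj⟩, fun j => ⟨hW j, hWc j, hWh j, hvis _ (hW j) (hWc j)⟩⟩
  obtain ⟨j, -, hj⟩ := Metric.nhds_basis_ball_inv_nat_succ.mem_iff.1 hs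
  exact ⟨j, trivial, (hWb j).trans hj⟩
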